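/- Let $N\in\mathbb{N}\cup\{\infty\}$ and let $A,B$ be row-finite $N\times N$ matrices with integer entries and no identically zero row, such that $A_{i,j}\ge 0$ for all $i,j$, and $B_{i,j}=0$ whenever $A_{i,j}=0$. If $N=\infty$, assume also that $A$ has no identically zero column. Let $E$ be the directed graph with vertex set $E^0=\{1,\dots,N\}$ ($E^0=\mathbb{N}$ if $N=\infty$) and edges $e_{i,j,n}$, $0\le n<A_{i,j}$, with source $s(e_{i,j,n})=i$ and range $r(e_{i,j,n})=j$. Let $E^n$ be the set of paths $\alpha=\alpha_1\cdots\alpha_n$ of length $|\alpha|=n$, where $r(\alpha_i)=s(\alpha_{i+1})$ (with $E^0$ the set of paths of length zero), let $E^\infty$ be the space of infinite paths with the topology induced from the product of discrete spaces, and let $Z(\alpha)=\{\alpha y: y\in E^\infty,\ s(y)=r(\alpha)\}$. For $m\in\mathbb{Z}$ and an edge $e=e_{i,j,n}$, write $mB_{i,j}+n=kA_{i,j}+l$ with $k,l\in\mathbb{Z}$, $0\le l<A_{i,j}$, and put $\kappa_m(e)=e_{i,j,l}$, $\varphi(m,e)=k$; extend $\kappa$ to infinite paths by $\kappa_m(ex)=\kappa_m(e)\,\kappa_{\varphi(m,e)}(x)$.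 Assume that the pair $A,B$ is pseudo free: if $\kappa_m(e)=e$ and $\varphi(m,e)=0$ for some edge $e$, then $m=0$. Let $\mathcal{G}_{A,B}$ be the étale groupoid of classes $[\alpha,m,\beta;x]$, where $\alpha,\beta$ are finite paths with $r(\alpha)=r(\beta)$, $m\in\mathbb{Z}$ and $x\in Z(\beta)$, under the equivalence relation generated by $(\alpha,m,\beta;x)\sim(\alpha\kappa_m(\gamma),\varphi(m,\gamma),\beta\gamma;x)$ for edges $\gamma$ with $s(\gamma)=r(\beta)$ and $x\in Z(\beta\gamma)$. Its unit space is $E^\infty$, with $s([\alpha,m,\beta;\beta y])=\beta y$ and $r([\alpha,m,\beta;\beta y])=\alpha\kappa_m(y)$; its product and inverse are $$[\alpha,m',\beta;\beta\kappa_m(y)]\cdot[\beta,m,\gamma;\gamma y]=[\alpha,m'+m,\gamma;\gamma y],\qquad [\alpha,m,\beta;\beta y]^{-1}=[\beta,-m,\alpha;\alpha\kappa_m(y)],$$ and its topology has as a basis the sets $Z(\alpha,m,\beta;Z(\beta))=\{[\alpha,m,\beta;x]:x\in Z(\beta)\}$. Let $\mathcal{H}_{A,B}$ be the kernel of the homomorphism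 $\rho:\mathcal{G}_{A,B}\to\mathbb{Z}$, $[\alpha,m,\beta;x]\mapsto|\alpha|-|\beta|$. For an étale groupoid $\mathcal{G}$, let $H_1(\mathcal{G})=\ker\delta_1/\operatorname{im}\delta_2$, where $\delta_1=s_*-r_*:C_c(\mathcal{G},\mathbb{Z})\to C_c(\mathcal{G}^{(0)},\mathbb{Z})$ and $\delta_2=d_{0*}-d_{1*}+d_{2*}:C_c(\mathcal{G}^{(2)},\mathbb{Z})\to C_c(\mathcal{G},\mathbb{Z})$, with $\mathcal{G}^{(2)}$ the space of composable pairs, $d_0(g,h)=h$, $d_1(g,h)=gh$, $d_2(g,h)=g$, and $\pi_*f(y)=\sum_{\pi(x)=y}f(x)$. Let $\mathbb{Z}_B$ be the inductive limit of the sequence $\mathbb{Z}^{(E^0)}\to\mathbb{Z}^{(E^0)}\to\cdots$ of free abelian groups on $E^0$, indexed by $n=0,1,2,\dots$, in which every map is $\mathbf{1}_v\mapsto\sum_w B_{v,w}\mathbf{1}_w$, and let $\varphi^B_{n,\infty}:\mathbb{Z}^{(E^0)}\to\mathbb{Z}_B$ be the canonical map from stage $n$. Then, for every $n\ge 0$ and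 every $\alpha\in E^n$, the function $\mathbf{1}_{Z(\alpha,1,\alpha;Z(\alpha))}$ belongs to $C_c(\mathcal{H}_{A,B},\mathbb{Z})$ and is a $1$-cycle, and there is a unique group isomorphism $\Phi_B:H_1(\mathcal{H}_{A,B})\to\mathbb{Z}_B$ such that $$\Phi_B\big([\mathbf{1}_{Z(\alpha,1,\alpha;Z(\alpha))}]\big)=\varphi^B_{n,\infty}(\mathbf{1}_{r(\alpha)})\qquad\text{for all } n\ge 0,\ \alpha\in E^n.$$ -/

import Mathlib

open scoped CompactlySupported

/-! ### Étale groupoids and their first homology group -/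

/-- An étale groupoid with space of arrows `G` and unit space `X`, with source map `s`, range
map `r`, and partially defined product `mul g h` for `s g = r h`. Continuity of `r`, and the fact
that `r` is a local homeomorphism, follow from `r = s ∘ inv`. -/
structure EtaleGroupoid (G X : Type*) [TopologicalSpace G] [TopologicalSpace X] where
  s : G → X
  r : G → X
  one : X → G
  mul : (g h : G) → s g = r h → G
  inv : G → G
  s_one : ∀ x, s (one x) = x
  r_one : ∀ x, r (one x) = x
  s_mul : ∀ g h c, s (mul g h c) = s h
  r_mul : ∀ g h c, r (mul g h c) = r g
  s_inv : ∀ g, s (inv g) = r g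
  r_inv : ∀ g, r (inv g) = s g
  one_mul : ∀ g, mul (one (r g)) g (s_one _) = g
  mul_one : ∀ g, mul g (one (s g)) (r_one _).symm = g
  mul_assoc : ∀ g h k (c : s g = r h) (d : s h = r k),
    mul (mul g h c) k ((s_mul g h c).trans d) = mul g (mul h k d) (c.trans (r_mul h k d).symm)
  inv_mul : ∀ g, mul (inv g) g (s_inv g) = one (s g)
  mul_inv : ∀ g, mul g (inv g) (r_inv g).symm = one (r g)
  continuous_one : Continuous one
  continuous_inv : Continuous inv
  continuous_mul : Continuous fun p : {p : G × G // s p.1 = r p.2} => mul p.1.1 p.1.2 p.2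
  isLocalHomeomorph_s : IsLocalHomeomorph s

section Pushforward

variable {X Y : Type*} [TopologicalSpace X]

/-- A compactly supported function meets each fibre of a locally injective map in a finite set. -/
theorem finite_support_fibre {π : X → Y} (hπ : IsLocallyInjective π) (f : C_c(X, ℤ)) (y : Y) :
    (Function.support fun x : {x : X // π x = y} => f x).Finite := by
  have hcov := hπ
  choose U hU hxU hinj using hcov
  obtain ⟨t, ht⟩ := f.hasCompactSupport.isCompact.elim_finite_subcover U hU
    (fun x _ => Set.mem_iUnion.2 ⟨x, hxU x⟩)
  have hsub : (Function.support fun x : {x : X // π x = y} => f x) ⊆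
      ⋃ i ∈ t, {x : {x : X // π x = y} | (x : X) ∈ U i} := by
    intro x hx
    have h1 : (x : X) ∈ tsupport f := subset_tsupport _ hx
    simpa using ht h1
  refine Set.Finite.subset (t.finite_toSet.biUnion fun i _ => ?_) hsub
  refine Set.Subsingleton.finite ?_
  intro a ha b hb
  exact Subtype.ext (hinj i ha hb (a.2.trans b.2.symm))

/-- The pushforward `π_* f (y) = ∑_{π x = y} f x`; the sum has finitely many nonzero terms. -/
noncomputable def pushforward (π : X → Y) (hπ : IsLocallyInjective π) : C_c(X, ℤ) →+ (Y → ℤ) where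
  toFun f y := ∑ᶠ x : {x : X // π x = y}, f x
  map_zero' := by ext y; simp
  map_add' f g := by
    ext y
    exact finsum_add_distrib (finite_support_fibre hπ f y) (finite_support_fibre hπ g y)

end Pushforward

namespace EtaleGroupoid

variable {G X : Type*} [TopologicalSpace G] [TopologicalSpace X] (𝒢 : EtaleGroupoid G X)

/-- The space of composable pairs. -/
abbrev Pairs : Type _ := {p : G × G // 𝒢.s p.1 = 𝒢.r p.2}

def d₀ (p : 𝒢.Pairs) : G := p.1.2

def d₁ (p : 𝒢.Pairs) : G := 𝒢.mul p.1.1 p.1.2 p.2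

def d₂ (p : 𝒢.Pairs) : G := p.1.1

theorem locInj_s : IsLocallyInjective 𝒢.s := 𝒢.isLocalHomeomorph_s.isLocallyInjective

theorem inv_inv (g : G) : 𝒢.inv (𝒢.inv g) = g := by
  have h1 := 𝒢.mul_assoc (𝒢.inv (𝒢.inv g)) (𝒢.inv g) g (𝒢.s_inv _) (𝒢.s_inv _)
  have key : ∀ (a b : G) (c) (b' : G) (hb : b = b'), 𝒢.mul a b c = 𝒢.mul a b' (hb ▸ c) := by
    rintro a b c b' rfl; rfl
  have key' : ∀ (a b : G) (c) (a' : G) (ha : a = a'), 𝒢.mul a b c = 𝒢.mul a' b (ha ▸ c) := by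
    rintro a b c b' rfl; rfl
  have hs : 𝒢.s (𝒢.inv (𝒢.inv g)) = 𝒢.s g := by rw [𝒢.s_inv, 𝒢.r_inv]
  have hs' : 𝒢.s (𝒢.inv g) = 𝒢.r g := 𝒢.s_inv g
  rw [key' _ g _ _ (𝒢.inv_mul (𝒢.inv g)), key _ _ _ _ (𝒢.inv_mul g),
    key' _ g _ (𝒢.one (𝒢.r g)) (by rw [hs']), 𝒢.one_mul,
    key _ _ _ (𝒢.one (𝒢.s (𝒢.inv (𝒢.inv g)))) (by rw [hs]), 𝒢.mul_one] at h1
  exact h1.symm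

theorem locInj_r : IsLocallyInjective 𝒢.r := by
  intro g
  obtain ⟨U, hU, hg, hinj⟩ := 𝒢.locInj_s (𝒢.inv g)
  refine ⟨𝒢.inv ⁻¹' U, hU.preimage 𝒢.continuous_inv, hg, ?_⟩
  intro a ha b hb hab
  have := hinj ha hb (by rw [𝒢.s_inv, 𝒢.s_inv, hab])
  rw [← 𝒢.inv_inv a, this, 𝒢.inv_inv]

theorem locInj_d₀ : IsLocallyInjective 𝒢.d₀ := by
  rintro ⟨⟨g, h⟩, c⟩
  obtain ⟨U, hU, hg, hinj⟩ := 𝒢.locInj_s g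
  refine ⟨{p | p.1.1 ∈ U}, hU.preimage (by fun_prop), hg, ?_⟩
  rintro ⟨⟨a, b⟩, c⟩ ha ⟨⟨a', b'⟩, c'⟩ ha' (hb : b = b')
  subst hb
  have : a = a' := hinj ha ha' (c.trans c'.symm)
  subst this
  rfl

theorem locInj_d₂ : IsLocallyInjective 𝒢.d₂ := by
  rintro ⟨⟨g, h⟩, c⟩
  obtain ⟨U, hU, hg, hinj⟩ := 𝒢.locInj_r h
  refine ⟨{p | p.1.2 ∈ U}, hU.preimage (by fun_prop), hg, ?_⟩
  rintro ⟨⟨a, b⟩, c⟩ ha ⟨⟨a', b'⟩, c'⟩ ha' (hb : a = a')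
  subst hb
  have : b = b' := hinj ha ha' (c.symm.trans c')
  subst this
  rfl

theorem locInj_d₁ : IsLocallyInjective 𝒢.d₁ := by
  rintro ⟨⟨g, h⟩, c⟩
  obtain ⟨U, hU, hg, hinj⟩ := 𝒢.locInj_r g
  obtain ⟨W, hW, hh, hinjW⟩ := 𝒢.locInj_s h
  refine ⟨{p | p.1.1 ∈ U ∧ p.1.2 ∈ W}, (hU.preimage (by fun_prop)).inter
    (hW.preimage (by fun_prop)), ⟨hg, hh⟩, ?_⟩
  rintro ⟨⟨a, b⟩, c⟩ ⟨ha, hb⟩ ⟨⟨a', b'⟩, c'⟩ ⟨ha', hb'⟩ (hm : 𝒢.mul a b c = 𝒢.mul a' b' c')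
  have h1 : a = a' := hinj ha ha' (by rw [← 𝒢.r_mul a b c, hm, 𝒢.r_mul])
  have h2 : b = b' := hinjW hb hb' (by rw [← 𝒢.s_mul a b c, hm, 𝒢.s_mul])
  subst h1 h2
  rfl

/-- `δ₁ = s_* - r_*`. -/
noncomputable def δ₁ : C_c(G, ℤ) →+ (X → ℤ) :=
  pushforward 𝒢.s 𝒢.locInj_s - pushforward 𝒢.r 𝒢.locInj_r

/-- `δ₂ = d₀_* - d₁_* + d₂_*`. -/
noncomputable def δ₂ : C_c(𝒢.Pairs, ℤ) →+ (G → ℤ) :=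
  pushforward 𝒢.d₀ 𝒢.locInj_d₀ - pushforward 𝒢.d₁ 𝒢.locInj_d₁ + pushforward 𝒢.d₂ 𝒢.locInj_d₂

/-- The group of 1-cycles `ker δ₁`. -/
noncomputable def cycles₁ : AddSubgroup C_c(G, ℤ) := 𝒢.δ₁.ker

/-- The 1-boundaries: those 1-cycles which, as functions, are of the form `δ₂ h`. -/
noncomputable def boundaries₁ : AddSubgroup 𝒢.cycles₁ where
  carrier := {z | ∃ h : C_c(𝒢.Pairs, ℤ), 𝒢.δ₂ h = ⇑(z : C_c(G, ℤ))}
  zero_mem' := ⟨0, by simp⟩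
  add_mem' := by
    rintro a b ⟨h, hh⟩ ⟨k, hk⟩
    exact ⟨h + k, by simp [hh, hk]⟩
  neg_mem' := by
    rintro a ⟨h, hh⟩
    exact ⟨-h, by simp [hh]⟩

/-- The first homology group `H₁ = ker δ₁ / im δ₂`. -/
abbrev H₁ : Type _ := 𝒢.cycles₁ ⧸ 𝒢.boundaries₁

/-- The homology class of a 1-cycle. -/
noncomputable def homologyClass (z : 𝒢.cycles₁) : 𝒢.H₁ := QuotientAddGroup.mk z

/-- The kernel of a continuous groupoid homomorphism `ρ : G → ℤ`, an open subgroupoid with the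
same unit space. -/
def ker (ρ : G → ℤ) (hmul : ∀ g h c, ρ (𝒢.mul g h c) = ρ g + ρ h) (hρ : Continuous ρ) :
    EtaleGroupoid {g : G // ρ g = 0} X :=
  have hone : ∀ x, ρ (𝒢.one x) = 0 := fun x => by
    have h1 := hmul (𝒢.one (𝒢.r (𝒢.one x))) (𝒢.one x) (𝒢.s_one _)
    rw [𝒢.one_mul, 𝒢.r_one] at h1
    linarith
  have hinv : ∀ g, ρ g = 0 → ρ (𝒢.inv g) = 0 := fun g hg => by
    have h1 := hmul (𝒢.inv g) g (𝒢.s_inv g)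
    rw [𝒢.inv_mul, hone, hg] at h1
    linarith
  { s := fun g => 𝒢.s g.1
    r := fun g => 𝒢.r g.1
    one := fun x => ⟨𝒢.one x, hone x⟩
    mul := fun g h c => ⟨𝒢.mul g.1 h.1 c, by rw [hmul, g.2, h.2, add_zero]⟩
    inv := fun g => ⟨𝒢.inv g.1, hinv g.1 g.2⟩
    s_one := fun x => 𝒢.s_one x
    r_one := fun x => 𝒢.r_one x
    s_mul := fun g h c => 𝒢.s_mul g.1 h.1 c
    r_mul := fun g h c => 𝒢.r_mul g.1 h.1 c
    s_inv := fun g => 𝒢.s_inv g.1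
    r_inv := fun g => 𝒢.r_inv g.1
    one_mul := fun g => Subtype.ext (𝒢.one_mul g.1)
    mul_one := fun g => Subtype.ext (𝒢.mul_one g.1)
    mul_assoc := fun g h k c d => Subtype.ext (𝒢.mul_assoc g.1 h.1 k.1 c d)
    inv_mul := fun g => Subtype.ext (𝒢.inv_mul g.1)
    mul_inv := fun g => Subtype.ext (𝒢.mul_inv g.1)
    continuous_one := 𝒢.continuous_one.subtype_mk _
    continuous_inv := (𝒢.continuous_inv.comp continuous_subtype_val).subtype_mk _
    continuous_mul := by
      refine Continuous.subtype_mk (𝒢.continuous_mul.comp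
        (f := fun p : {p : {g : G // ρ g = 0} × {g : G // ρ g = 0} //
          𝒢.s p.1.1 = 𝒢.r p.2.1} => (⟨(p.1.1.1, p.1.2.1), p.2⟩ :
            {p : G × G // 𝒢.s p.1 = 𝒢.r p.2})) ?_) _
      fun_prop
    isLocalHomeomorph_s := 𝒢.isLocalHomeomorph_s.comp
      ((isOpen_discrete ({0} : Set ℤ)).preimage hρ).isOpenEmbedding_subtypeVal.isLocalHomeomorph }

end EtaleGroupoid

/-! ### The graph of `A`, the action `κ` and the cocycle `φ` -/

namespace Katsura

variable {V : Type*}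

/-- The edges `e_{i,j,n}`, `0 ≤ n < A i j`, from `i` to `j`. -/
@[ext]
structure Edge (A : Matrix V V ℤ) where
  src : V
  tgt : V
  idx : ℤ
  idx_nonneg : 0 ≤ idx
  idx_lt : idx < A src tgt

variable {A : Matrix V V ℤ} (B : Matrix V V ℤ)

theorem Edge.pos (e : Edge A) : 0 < A e.src e.tgt := e.idx_nonneg.trans_lt e.idx_lt

/-- `κ_m(e_{i,j,n}) = e_{i,j,l}`, where `m B_{i,j} + n = k A_{i,j} + l` and `0 ≤ l < A_{i,j}`. -/
@[simps]
def Edge.act (m : ℤ) (e : Edge A) : Edge A where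
  src := e.src
  tgt := e.tgt
  idx := (m * B e.src e.tgt + e.idx) % A e.src e.tgt
  idx_nonneg := Int.emod_nonneg _ e.pos.ne'
  idx_lt := Int.emod_lt_of_pos _ e.pos

/-- `φ(m, e_{i,j,n}) = k`, where `m B_{i,j} + n = k A_{i,j} + l` and `0 ≤ l < A_{i,j}`. -/
def Edge.cocycle (m : ℤ) (e : Edge A) : ℤ := (m * B e.src e.tgt + e.idx) / A e.src e.tgt

theorem Edge.act_zero (e : Edge A) : e.act B 0 = e := by
  ext <;> simp [Int.emod_eq_of_lt e.idx_nonneg e.idx_lt]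

theorem Edge.cocycle_zero (e : Edge A) : e.cocycle B 0 = 0 := by
  simp [Edge.cocycle, Int.ediv_eq_zero_of_lt e.idx_nonneg e.idx_lt]

theorem Edge.act_add (m m' : ℤ) (e : Edge A) :
    e.act B (m + m') = (e.act B m').act B m := by
  ext
  · rfl
  · rfl
  · simp only [Edge.act_idx, Edge.act_src, Edge.act_tgt, Int.add_emod_emod]
    ring_nf

theorem Edge.cocycle_add (m m' : ℤ) (e : Edge A) :
    e.cocycle B (m + m') = (e.act B m').cocycle B m + e.cocycle B m' := by
  simp only [Edge.cocycle, Edge.act_idx, Edge.act_src, Edge.act_tgt]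
  have h := Int.emod_add_mul_ediv (m' * B e.src e.tgt + e.idx) (A e.src e.tgt)
  have h2 : (m + m') * B e.src e.tgt + e.idx =
      (m * B e.src e.tgt + (m' * B e.src e.tgt + e.idx) % A e.src e.tgt) +
        A e.src e.tgt * ((m' * B e.src e.tgt + e.idx) / A e.src e.tgt) := by
    linear_combination -h
  rw [h2, Int.add_mul_ediv_left _ _ e.pos.ne']

/-- The pair `A`, `B` is pseudo free. -/
def PseudoFree (A B : Matrix V V ℤ) : Prop :=
  ∀ (m : ℤ) (e : Edge A), e.act B m = e → e.cocycle B m = 0 → m = 0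

/-- Row-finiteness; for integer entries, `∑_j |A i j| < ∞` says that row `i` is finitely
supported. -/
def RowFinite (A : Matrix V V ℤ) : Prop := ∀ i, (Function.support (A i)).Finite

/-! ### Finite and infinite paths -/

/-- `IsWalk v l w`: the list of edges `l` is a path from `v` to `w`. -/
def IsWalk : V → List (Edge A) → V → Prop
  | v, [], w => v = w
  | v, e :: l, w => v = e.src ∧ IsWalk e.tgt l w

theorem IsWalk.concat {v w : V} {l : List (Edge A)} (h : IsWalk v l w) (e : Edge A)
    (he : e.src = w) : IsWalk v (l ++ [e]) e.tgt := by
  induction l generalizing v with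
  | nil => exact ⟨Eq.trans h he.symm, rfl⟩
  | cons f l ih => exact ⟨h.1, ih h.2⟩

variable (A) in
/-- Finite paths; the paths of length zero are the vertices. -/
@[ext]
structure FinPath where
  src : V
  tgt : V
  edges : List (Edge A)
  isWalk : IsWalk src edges tgt

namespace FinPath

/-- The vertex `v` as a path of length zero. -/
def vertex (A : Matrix V V ℤ) (v : V) : FinPath A := ⟨v, v, [], rfl⟩

def length (α : FinPath A) : ℕ := α.edges.length

/-- The path `α e`. -/
def snoc (α : FinPath A) (e : Edge A) (h : e.src = α.tgt) : FinPath A :=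
  ⟨α.src, e.tgt, α.edges ++ [e], α.isWalk.concat e h⟩

@[simp] theorem length_snoc (α : FinPath A) (e : Edge A) (h : e.src = α.tgt) :
    (α.snoc e h).length = α.length + 1 := by simp [length, snoc]

end FinPath

instance : TopologicalSpace (Edge A) := ⊥

instance : DiscreteTopology (Edge A) := ⟨rfl⟩

variable (A) in
/-- Infinite paths, with the topology induced by the product of discrete spaces. -/
abbrev InfPath : Type _ := {x : ℕ → Edge A // ∀ i, (x i).tgt = (x (i + 1)).src}

/-- The sequence consisting of the list `l` followed by the sequence `x`. -/
def prepend : List (Edge A) → (ℕ → Edge A) → ℕ → Edge A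
  | [], x, n => x n
  | e :: _, _, 0 => e
  | _ :: l, x, n + 1 => prepend l x n

theorem prepend_append (l l' : List (Edge A)) (x : ℕ → Edge A) :
    prepend (l ++ l') x = prepend l (prepend l' x) := by
  induction l with
  | nil => rfl
  | cons e l ih => funext n; cases n with
    | zero => rfl
    | succ n => simp [prepend, ih]

theorem prepend_add (l : List (Edge A)) (x : ℕ → Edge A) (n : ℕ) :
    prepend l x (l.length + n) = x n := by
  induction l with
  | nil => simp [prepend]
  | cons e l ih =>
    rw [List.length_cons, show l.length + 1 + n = (l.length + n) + 1 by omega]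
    exact ih

theorem prepend_eq_of_lt (l : List (Edge A)) (x y : ℕ → Edge A) (n : ℕ) (h : n < l.length) :
    prepend l x n = prepend l y n := by
  induction l generalizing n with
  | nil => simp at h
  | cons e l ih => cases n with
    | zero => rfl
    | succ n => exact ih n (by simpa using h)

theorem prepend_injective {l l' : List (Edge A)} (hl : l.length = l'.length) {x x' : ℕ → Edge A}
    (h : prepend l x = prepend l' x') : l = l' ∧ x = x' := by
  induction l generalizing l' with
  | nil => cases l' with
    | nil => exact ⟨rfl, h⟩
    | cons e l' => simp at hl
  | cons e l ih => cases l' with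
    | nil => simp at hl
    | cons e' l' =>
      have h0 : e = e' := congrFun h 0
      obtain ⟨h1, h2⟩ := ih (l' := l') (by simpa using hl) (funext fun n => congrFun h (n + 1))
      exact ⟨by rw [h0, h1], h2⟩

theorem prepend_isPath {v w : V} {l : List (Edge A)} (hl : IsWalk v l w) (y : InfPath A)
    (hy : (y.1 0).src = w) :
    (∀ i, (prepend l y.1 i).tgt = (prepend l y.1 (i + 1)).src) ∧ (prepend l y.1 0).src = v := by
  induction l generalizing v with
  | nil => exact ⟨y.2, hy.trans hl.symm⟩
  | cons e l ih =>
    obtain ⟨h1, h2⟩ := ih hl.2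
    refine ⟨fun i => ?_, hl.1.symm⟩
    cases i with
    | zero => exact h2.symm
    | succ i => exact h1 i

namespace InfPath

/-- The source of an infinite path. -/
def src (x : InfPath A) : V := (x.1 0).src

/-- The infinite path `x_{n+1} x_{n+2} ⋯` obtained by deleting the first `n` edges. -/
def drop (n : ℕ) (x : InfPath A) : InfPath A :=
  ⟨fun i => x.1 (n + i), fun i => x.2 (n + i)⟩

/-- The integers `m, φ(m, x₁), φ(m, x₁x₂), …`. -/
def carry (m : ℤ) (x : InfPath A) : ℕ → ℤ
  | 0 => m
  | n + 1 => (x.1 n).cocycle B (carry m x n)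

/-- The action `κ_m` on infinite paths, `κ_m(e x) = κ_m(e) κ_{φ(m,e)}(x)`. -/
def act (m : ℤ) (x : InfPath A) : InfPath A :=
  ⟨fun n => (x.1 n).act B (x.carry B m n), fun i => x.2 i⟩

@[simp] theorem src_act (m : ℤ) (x : InfPath A) : (x.act B m).src = x.src := rfl

theorem carry_add (m m' : ℤ) (x : InfPath A) (n : ℕ) :
    x.carry B (m + m') n = (x.act B m').carry B m n + x.carry B m' n := by
  induction n with
  | zero => rfl
  | succ n ih => simp only [carry, ih, Edge.cocycle_add]; rfl

theorem act_add (m m' : ℤ) (x : InfPath A) : x.act B (m + m') = (x.act B m').act B m := by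
  refine Subtype.ext (funext fun n => ?_)
  simp only [act, carry_add, Edge.act_add]

theorem carry_zero (x : InfPath A) (n : ℕ) : x.carry B 0 n = 0 := by
  induction n with
  | zero => rfl
  | succ n ih => simp [carry, ih, Edge.cocycle_zero]

theorem act_zero (x : InfPath A) : x.act B 0 = x := by
  refine Subtype.ext (funext fun n => ?_)
  simp [act, carry_zero, Edge.act_zero]

theorem carry_drop_one (m : ℤ) (x : InfPath A) (n : ℕ) :
    (x.drop 1).carry B ((x.1 0).cocycle B m) n = x.carry B m (n + 1) := by
  induction n with
  | zero => rfl
  | succ n ih =>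
    rw [carry, ih]
    change (x.1 (1 + n)).cocycle B _ = (x.1 (n + 1)).cocycle B _
    rw [add_comm 1 n]

theorem act_drop_one (m : ℤ) (x : InfPath A) :
    (x.drop 1).act B ((x.1 0).cocycle B m) = (x.act B m).drop 1 := by
  refine Subtype.ext (funext fun n => ?_)
  change (x.1 (1 + n)).act B ((x.drop 1).carry B _ n) = (x.1 (1 + n)).act B (x.carry B m (1 + n))
  rw [carry_drop_one, add_comm 1 n]

end InfPath

namespace FinPath

/-- The infinite path `α y`. -/
def concat (α : FinPath A) (y : InfPath A) (h : y.src = α.tgt) : InfPath A :=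
  ⟨prepend α.edges y.1, (prepend_isPath α.isWalk y h).1⟩

/-- The cylinder set `Z(α) = {α y : s(y) = r(α)}`. -/
def Z (α : FinPath A) : Set (InfPath A) := {x | ∃ y h, x = α.concat y h}

theorem drop_concat (α : FinPath A) (y : InfPath A) (h : y.src = α.tgt) :
    (α.concat y h).drop α.length = y :=
  Subtype.ext (funext fun n => prepend_add α.edges y.1 n)

theorem src_concat (α : FinPath A) (y : InfPath A) (h : y.src = α.tgt) :
    (α.concat y h).src = α.src := (prepend_isPath α.isWalk y h).2

theorem src_drop_of_mem {α : FinPath A} {x : InfPath A} (hx : x ∈ α.Z) :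
    (x.drop α.length).src = α.tgt := by
  obtain ⟨y, h, rfl⟩ := hx
  rw [drop_concat, h]

theorem src_apply_of_mem {α : FinPath A} {x : InfPath A} (hx : x ∈ α.Z) :
    (x.1 α.length).src = α.tgt := src_drop_of_mem hx

theorem concat_drop_of_mem {α : FinPath A} {x : InfPath A} (hx : x ∈ α.Z) :
    α.concat (x.drop α.length) (src_drop_of_mem hx) = x := by
  obtain ⟨y, h, rfl⟩ := hx
  simp only [drop_concat]

theorem concat_mem (α : FinPath A) (y : InfPath A) (h : y.src = α.tgt) : α.concat y h ∈ α.Z :=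
  ⟨y, h, rfl⟩

theorem eq_of_mem {α β : FinPath A} {x : InfPath A} (hα : x ∈ α.Z) (hβ : x ∈ β.Z)
    (hl : α.length = β.length) : α = β := by
  obtain ⟨y, h, rfl⟩ := hα
  obtain ⟨y', h', he⟩ := hβ
  obtain ⟨h1, h2⟩ := prepend_injective hl (congrArg Subtype.val he)
  have h3 : y = y' := Subtype.ext h2
  subst h3
  refine FinPath.ext ?_ (h.symm.trans h') h1
  rw [← α.src_concat y h, he, src_concat]

theorem mem_Z_iff {α : FinPath A} {x x' : InfPath A} (hx : x ∈ α.Z) :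
    x' ∈ α.Z ↔ x'.src = x.src ∧ ∀ i < α.length, x'.1 i = x.1 i := by
  constructor
  · intro hx'
    obtain ⟨y, h, rfl⟩ := hx
    obtain ⟨y', h', rfl⟩ := hx'
    exact ⟨by rw [src_concat, src_concat], fun i hi => prepend_eq_of_lt _ _ _ i hi⟩
  · rintro ⟨hs, he⟩
    have hsrc : (x'.drop α.length).src = α.tgt := by
      rw [← src_drop_of_mem hx]
      rcases hα : α.length with _ | n
      · exact hs
      · have h1 := x'.2 n
        have h2 := x.2 n
        rw [he n (by omega)] at h1
        exact h1.symm.trans h2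
    refine ⟨x'.drop α.length, hsrc, Subtype.ext (funext fun i => ?_)⟩
    rcases lt_or_ge i α.length with hi | hi
    · rw [he i hi, ← concat_drop_of_mem hx]
      exact prepend_eq_of_lt _ _ _ i hi
    · obtain ⟨k, rfl⟩ := Nat.exists_eq_add_of_le hi
      exact (prepend_add α.edges (x'.drop α.length).1 k).symm

theorem snoc_mem {α : FinPath A} {x : InfPath A} (hx : x ∈ α.Z) :
    x ∈ (α.snoc (x.1 α.length) (src_apply_of_mem hx)).Z := by
  refine ⟨(x.drop α.length).drop 1, ?_, ?_⟩
  · exact (x.2 α.length).symm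
  · conv_lhs => rw [← concat_drop_of_mem hx]
    refine Subtype.ext ?_
    change prepend α.edges _ = prepend (α.edges ++ [_]) _
    rw [prepend_append]
    congr 1
    funext n
    cases n with
    | zero => rfl
    | succ n => simp [prepend, InfPath.drop, add_comm 1 n]

theorem mem_of_snoc_mem {α : FinPath A} {e : Edge A} (h : e.src = α.tgt) {x : InfPath A}
    (hx : x ∈ (α.snoc e h).Z) : x ∈ α.Z ∧ x.1 α.length = e := by
  obtain ⟨y, hy, rfl⟩ := hx
  have hw : IsWalk e.src [e] e.tgt := ⟨rfl, rfl⟩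
  have h1 := prepend_isPath hw y hy
  have h2 : (α.snoc e h).concat y hy = α.concat ⟨prepend [e] y.1, h1.1⟩ (h1.2.trans h) :=
    Subtype.ext (prepend_append _ _ _)
  refine ⟨⟨_, _, h2⟩, ?_⟩
  rw [h2]
  exact prepend_add α.edges _ 0

theorem isOpen_Z (α : FinPath A) : IsOpen α.Z := by
  rw [isOpen_iff_forall_mem_open]
  intro x hx
  refine ⟨{x' | ∀ i < α.length + 1, x'.1 i = x.1 i}, ?_, ?_, fun i _ => rfl⟩
  · intro x' hx'
    refine (mem_Z_iff hx).2 ⟨?_, fun i hi => hx' i (by omega)⟩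
    exact congrArg Edge.src (hx' 0 (by omega))
  · exact (PiNat.isOpen_cylinder (fun _ => Edge A) x.1 (α.length + 1)).preimage
      continuous_subtype_val

end FinPath

theorem InfPath.exists_cylinder {U : Set (InfPath A)} (hU : IsOpen U) {x : InfPath A}
    (hx : x ∈ U) : ∃ n, ∀ x' : InfPath A, (∀ i < n, x'.1 i = x.1 i) → x' ∈ U := by
  obtain ⟨W, hW, rfl⟩ := hU
  obtain ⟨_, ⟨z, n, rfl⟩, hz, hsub⟩ :=
    (PiNat.isTopologicalBasis_cylinders (fun _ => Edge A)).exists_subset_of_mem_open hx hW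
  exact ⟨n, fun x' h => hsub fun i hi => (h i hi).trans (hz i hi)⟩

/-! ### The Katsura–Exel–Pardo groupoid -/

variable (A) in
/-- The triples `(α, m, β)` with `r(α) = r(β)`. -/
@[ext]
structure Triple where
  α : FinPath A
  m : ℤ
  β : FinPath A
  tgt_eq : α.tgt = β.tgt

/-- The triple `(α κ_m(γ), φ(m,γ), β γ)`. -/
def Triple.snoc (t : Triple A) (γ : Edge A) (h : γ.src = t.β.tgt) : Triple A where
  α := t.α.snoc (γ.act B t.m) (h.trans t.tgt_eq.symm)
  m := γ.cocycle B t.m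
  β := t.β.snoc γ h
  tgt_eq := rfl

variable (A) in
/-- The quadruples `(α, m, β; x)` with `x ∈ Z(β)`. -/
@[ext]
structure Quad where
  t : Triple A
  x : InfPath A
  mem : x ∈ t.β.Z

/-- The relation `(α, m, β; x) ∼ (α κ_m(γ), φ(m,γ), β γ; x)`, where `γ` is an edge with
`s(γ) = r(β)` and `x ∈ Z(β γ)`. -/
def Step (q q' : Quad A) : Prop :=
  q'.x = q.x ∧ ∃ γ h, q'.t = q.t.snoc B γ h

/-- The set of arrows `[α, m, β; x]`: the quotient by the equivalence relation generated by
`Step`. -/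
def Arrow (A B : Matrix V V ℤ) : Type _ := Quot (Step B : Quad A → Quad A → Prop)

namespace Quad

/-- The arrow `[α, m, β; x]`. -/
def mk' (q : Quad A) : Arrow A B := Quot.mk _ q

theorem src_act_drop (q : Quad A) :
    ((q.x.drop q.t.β.length).act B q.t.m).src = q.t.α.tgt :=
  (FinPath.src_drop_of_mem q.mem).trans q.t.tgt_eq.symm

/-- The range `α κ_m(y)` of `[α, m, β; β y]`. -/
def rng (q : Quad A) : InfPath A :=
  q.t.α.concat ((q.x.drop q.t.β.length).act B q.t.m) (q.src_act_drop B)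

theorem rng_mem (q : Quad A) : q.rng B ∈ q.t.α.Z := FinPath.concat_mem _ _ _

theorem drop_rng (q : Quad A) :
    (q.rng B).drop q.t.α.length = (q.x.drop q.t.β.length).act B q.t.m :=
  FinPath.drop_concat _ _ _

theorem rng_apply (q : Quad A) :
    (q.rng B).1 q.t.α.length = (q.x.1 q.t.β.length).act B q.t.m :=
  congrArg (fun y : InfPath A => y.1 0) (q.drop_rng B)

/-- The quadruple related to `q` by `Step`. -/
def next (q : Quad A) : Quad A :=
  ⟨q.t.snoc B (q.x.1 q.t.β.length) (FinPath.src_apply_of_mem q.mem), q.x, FinPath.snoc_mem q.mem⟩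

@[simp] theorem next_α_length (q : Quad A) : (q.next B).t.α.length = q.t.α.length + 1 :=
  FinPath.length_snoc _ ((q.x.1 q.t.β.length).act B q.t.m)
    ((FinPath.src_apply_of_mem q.mem).trans q.t.tgt_eq.symm)

@[simp] theorem next_β_length (q : Quad A) : (q.next B).t.β.length = q.t.β.length + 1 :=
  FinPath.length_snoc _ _ (FinPath.src_apply_of_mem q.mem)

theorem step_next (q : Quad A) : Step B q (q.next B) := ⟨rfl, _, _, rfl⟩

theorem step_iff {q q' : Quad A} : Step B q q' ↔ q' = q.next B := by
  refine ⟨?_, fun h => h ▸ q.step_next B⟩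
  rintro ⟨hx, γ, h, ht⟩
  obtain ⟨t', x', hm⟩ := q'
  obtain ⟨t, x, hm0⟩ := q
  simp only at hx ht
  subst hx ht
  obtain ⟨-, rfl⟩ := FinPath.mem_of_snoc_mem h hm
  rfl

theorem mk_next (q : Quad A) : (q.next B).mk' B = q.mk' B := (Quot.sound (q.step_next B)).symm

theorem mk_iterate (n : ℕ) (q : Quad A) : (((next B)^[n] q).mk' B) = q.mk' B := by
  induction n with
  | zero => rfl
  | succ n ih => rw [Function.iterate_succ_apply', mk_next, ih]

theorem mk_eq_iff {q q' : Quad A} :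
    q.mk' B = q'.mk' B ↔ ∃ n n', (next B)^[n] q = (next B)^[n'] q' := by
  constructor
  · intro h
    have h1 := Quot.eqvGen_exact h
    induction h1 with
    | rel a b hab => exact ⟨1, 0, ((step_iff B).1 hab).symm⟩
    | refl a => exact ⟨0, 0, rfl⟩
    | symm a b _ ih =>
      obtain ⟨n, n', h⟩ := ih (Quot.eqvGen_sound ‹_›)
      exact ⟨n', n, h.symm⟩
    | trans a b c hab hbc ih ih' =>
      obtain ⟨n, n', h⟩ := ih (Quot.eqvGen_sound hab)
      obtain ⟨k, k', h'⟩ := ih' (Quot.eqvGen_sound hbc)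
      refine ⟨k + n, n' + k', ?_⟩
      rw [Function.iterate_add_apply, h, ← Function.iterate_add_apply, add_comm k n',
        Function.iterate_add_apply, h', ← Function.iterate_add_apply]
  · rintro ⟨n, n', h⟩
    rw [← mk_iterate B n q, h, mk_iterate]

@[simp] theorem next_x (q : Quad A) : (q.next B).x = q.x := rfl

@[simp] theorem iterate_x (n : ℕ) (q : Quad A) : ((next B)^[n] q).x = q.x := by
  induction n with
  | zero => rfl
  | succ n ih => rw [Function.iterate_succ_apply', next_x, ih]

@[simp] theorem iterate_β_length (n : ℕ) (q : Quad A) :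
    ((next B)^[n] q).t.β.length = q.t.β.length + n := by
  induction n with
  | zero => rfl
  | succ n ih =>
    rw [Function.iterate_succ_apply', next_β_length, ih, add_assoc]

@[simp] theorem iterate_α_length (n : ℕ) (q : Quad A) :
    ((next B)^[n] q).t.α.length = q.t.α.length + n := by
  induction n with
  | zero => rfl
  | succ n ih =>
    rw [Function.iterate_succ_apply', next_α_length, ih, add_assoc]

theorem rng_next (q : Quad A) : (q.next B).rng B = q.rng B := by
  have h1 : (q.rng B) ∈ (q.next B).t.α.Z := by
    have h := FinPath.snoc_mem (q.rng_mem B)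
    simp only [rng_apply] at h
    exact h
  rw [← FinPath.concat_drop_of_mem h1]
  refine Subtype.ext (congrArg (prepend _) (congrArg Subtype.val ?_))
  have h4 : ∀ (k : ℕ) (x : InfPath A), x.drop (k + 1) = (x.drop k).drop 1 := fun k x =>
    Subtype.ext (funext fun i => congrArg x.1 (by ring))
  rw [next_α_length, next_β_length, h4 q.t.β.length, h4 q.t.α.length, drop_rng, ← InfPath.act_drop_one]
  rfl

@[simp] theorem rng_iterate (n : ℕ) (q : Quad A) : ((next B)^[n] q).rng B = q.rng B := by
  induction n with
  | zero => rfl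
  | succ n ih => rw [Function.iterate_succ_apply', rng_next, ih]

theorem ext' {q q' : Quad A} (hx : q.x = q'.x) (hr : q.rng B = q'.rng B)
    (hα : q.t.α.length = q'.t.α.length) (hβ : q.t.β.length = q'.t.β.length)
    (hm : q.t.m = q'.t.m) : q = q' :=
  Quad.ext (Triple.ext
    (FinPath.eq_of_mem (q.rng_mem B) (hr ▸ q'.rng_mem B) hα) hm
    (FinPath.eq_of_mem q.mem (hx ▸ q'.mem) hβ)) hx

/-- The quadruple `(β, -m, α; α κ_m(y))` for `q = (α, m, β; β y)`. -/
def inv (q : Quad A) : Quad A :=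
  ⟨⟨q.t.β, -q.t.m, q.t.α, q.t.tgt_eq.symm⟩, q.rng B, q.rng_mem B⟩

theorem rng_inv (q : Quad A) : (q.inv B).rng B = q.x := by
  rw [← FinPath.concat_drop_of_mem q.mem]
  refine Subtype.ext (congrArg (prepend _) (congrArg Subtype.val ?_))
  change ((q.rng B).drop q.t.α.length).act B (-q.t.m) = _
  rw [drop_rng, ← InfPath.act_add, neg_add_cancel, InfPath.act_zero]

theorem next_inv (q : Quad A) : (q.inv B).next B = (q.next B).inv B := by
  refine ext' B ?_ ?_ ?_ ?_ ?_
  · exact (rng_next B q).symm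
  · rw [rng_next, rng_inv, rng_inv, next_x]
  · exact (next_α_length B _).trans (next_β_length B q).symm
  · exact (next_β_length B _).trans (next_α_length B q).symm
  · change ((q.rng B).1 q.t.α.length).cocycle B (-q.t.m) = -((q.x.1 q.t.β.length).cocycle B q.t.m)
    have h := Edge.cocycle_add B (-q.t.m) q.t.m (q.x.1 q.t.β.length)
    rw [neg_add_cancel, Edge.cocycle_zero] at h
    rw [rng_apply]
    linarith

theorem iterate_inv (n : ℕ) (q : Quad A) : (next B)^[n] (q.inv B) = ((next B)^[n] q).inv B := by
  induction n with
  | zero => rfl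
  | succ n ih => rw [Function.iterate_succ_apply', ih, next_inv, Function.iterate_succ_apply']

/-- The quadruple `(α, m' + m, γ; x)` for `q' = (α, m', β; x')` and `q = (β, m, γ; x)`. -/
def comp (q' q : Quad A) (h : q'.t.β = q.t.α) : Quad A :=
  ⟨⟨q'.t.α, q'.t.m + q.t.m, q.t.β, q'.t.tgt_eq.trans (h ▸ q.t.tgt_eq)⟩, q.x, q.mem⟩

theorem rng_comp (q' q : Quad A) (h : q'.t.β = q.t.α) (hx : q'.x = q.rng B) :
    (comp q' q h).rng B = q'.rng B := by
  refine Subtype.ext (congrArg (prepend _) (congrArg Subtype.val ?_))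
  change (q.x.drop q.t.β.length).act B (q'.t.m + q.t.m) = _
  rw [InfPath.act_add, ← drop_rng, ← hx, h]

theorem next_β_eq {q' q : Quad A} (h : q'.t.β = q.t.α) (hx : q'.x = q.rng B) :
    (q'.next B).t.β = (q.next B).t.α := by
  refine FinPath.eq_of_mem (q'.next B).mem ?_ ?_
  · rw [next_x, hx, ← rng_next]
    exact rng_mem B _
  · rw [next_β_length, next_α_length, h]

theorem next_comp (q' q : Quad A) (h : q'.t.β = q.t.α) (hx : q'.x = q.rng B) :
    (comp q' q h).next B = comp (q'.next B) (q.next B) (next_β_eq B h hx) := by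
  refine ext' B rfl ?_ ?_ ?_ ?_
  · rw [rng_next, rng_comp B _ _ _ hx, rng_comp, rng_next]
    rw [next_x, rng_next, hx]
  · exact (next_α_length B _).trans (next_α_length B q').symm
  · rfl
  · change (q.x.1 q.t.β.length).cocycle B (q'.t.m + q.t.m) =
      (q'.x.1 q'.t.β.length).cocycle B q'.t.m + (q.x.1 q.t.β.length).cocycle B q.t.m
    rw [Edge.cocycle_add, hx, h, rng_apply]

theorem iterate_comp (n : ℕ) (q' q : Quad A) (h : q'.t.β = q.t.α) (hx : q'.x = q.rng B) :
    ∃ h', (next B)^[n] (comp q' q h) = comp ((next B)^[n] q') ((next B)^[n] q) h' := by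
  induction n with
  | zero => exact ⟨h, rfl⟩
  | succ n ih =>
    obtain ⟨h', e⟩ := ih
    have hx' : ((next B)^[n] q').x = ((next B)^[n] q).rng B := by simp [hx]
    simp only [Function.iterate_succ_apply']
    exact ⟨next_β_eq B h' hx', by rw [e, next_comp B _ _ h' hx']⟩

/-- The quadruple `(v, 0, v; x)`, where `v = s(x)`. -/
def unit (x : InfPath A) : Quad A :=
  ⟨⟨FinPath.vertex A x.src, 0, FinPath.vertex A x.src, rfl⟩, x, ⟨x, rfl, rfl⟩⟩

/-- The quadruple `(β, 0, β; x)`. -/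
def diag (β : FinPath A) (x : InfPath A) (hx : x ∈ β.Z) : Quad A := ⟨⟨β, 0, β, rfl⟩, x, hx⟩

theorem rng_diag (β : FinPath A) (x : InfPath A) (hx : x ∈ β.Z) : (diag β x hx).rng B = x := by
  refine Eq.trans ?_ (FinPath.concat_drop_of_mem hx)
  refine Subtype.ext (congrArg (prepend _) (congrArg Subtype.val ?_))
  exact InfPath.act_zero B _

theorem rng_unit (x : InfPath A) : (unit x).rng B = x := rng_diag B _ x _

theorem next_diag (β : FinPath A) (x : InfPath A) (hx : x ∈ β.Z) :
    (diag β x hx).next B = diag _ x (FinPath.snoc_mem hx) := by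
  refine ext' B rfl ?_ ?_ rfl ?_
  · rw [rng_next, rng_diag, rng_diag]
  · exact (next_α_length B _).trans (FinPath.length_snoc _ _ (FinPath.src_apply_of_mem hx)).symm
  · exact Edge.cocycle_zero B _

theorem iterate_unit (n : ℕ) (x : InfPath A) :
    ∃ β hx, β.length = n ∧ (next B)^[n] (unit x) = diag β x hx := by
  induction n with
  | zero => exact ⟨_, _, rfl, rfl⟩
  | succ n ih =>
    obtain ⟨β, hx, hl, e⟩ := ih
    exact ⟨_, FinPath.snoc_mem hx, by rw [FinPath.length_snoc, hl],
      by rw [Function.iterate_succ_apply', e, next_diag]⟩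

theorem mk_diag (β : FinPath A) (x : InfPath A) (hx : x ∈ β.Z) :
    (diag β x hx).mk' B = (unit x).mk' B := by
  obtain ⟨β', hx', hl, e⟩ := iterate_unit B β.length x
  obtain rfl := FinPath.eq_of_mem hx hx' hl.symm
  rw [← mk_iterate B β.length (unit x), e]

end Quad

namespace Arrow

variable {B}

/-- `s([α, m, β; x]) = x`. -/
def s : Arrow A B → InfPath A :=
  Quot.lift (fun q => q.x) fun _ _ h => h.1.symm

/-- `r([α, m, β; β y]) = α κ_m(y)`. -/
def r : Arrow A B → InfPath A :=
  Quot.lift (fun q => q.rng B) fun q q' h => by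
    rw [Quad.step_iff] at h; simp only [h, Quad.rng_next]

/-- The unit `[v, 0, v; x]`. -/
def one (x : InfPath A) : Arrow A B := (Quad.unit x).mk' B

/-- `[α, m, β; β y]⁻¹ = [β, -m, α; α κ_m(y)]`. -/
def inv : Arrow A B → Arrow A B :=
  Quot.lift (fun q => (q.inv B).mk' B) fun q q' h => by
    rw [Quad.step_iff] at h; simp only [h, ← Quad.next_inv, Quad.mk_next]

/-- The homomorphism `ρ([α, m, β; x]) = |α| - |β|`. -/
def ρ : Arrow A B → ℤ :=
  Quot.lift (fun q => (q.t.α.length : ℤ) - q.t.β.length) fun q q' h => by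
    rw [Quad.step_iff] at h
    have h1 := Quad.iterate_α_length B 1 q
    have h2 := Quad.iterate_β_length B 1 q
    simp only [Function.iterate_one] at h1 h2
    simp only [h, h1, h2]
    push_cast
    ring

/-- `IsMul g h k` says that, for suitable representatives, `g = [α, m', β; β κ_m(y)]`,
`h = [β, m, γ; γ y]` and `k = [α, m' + m, γ; γ y]`. -/
def IsMul (g h k : Arrow A B) : Prop :=
  ∃ (q' q : Quad A) (hm : q'.t.β = q.t.α), q'.x = q.rng B ∧
    g = q'.mk' B ∧ h = q.mk' B ∧ k = (q'.comp q hm).mk' B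

theorem exists_aligned (g h : Arrow A B) (c : g.s = h.r) :
    ∃ q' q : Quad A, q'.t.β = q.t.α ∧ q'.x = q.rng B ∧ g = q'.mk' B ∧ h = q.mk' B := by
  obtain ⟨q', rfl⟩ := Quot.exists_rep g
  obtain ⟨q, rfl⟩ := Quot.exists_rep h
  have hx : q'.x = q.rng B := c
  refine ⟨(Quad.next B)^[q.t.α.length] q', (Quad.next B)^[q'.t.β.length] q, ?_, by simp [hx],
    (Quad.mk_iterate B _ _).symm, (Quad.mk_iterate B _ _).symm⟩
  refine FinPath.eq_of_mem (Quad.mem _) ?_ (by simp [add_comm])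
  have := Quad.rng_mem B ((Quad.next B)^[q'.t.β.length] q)
  simpa [hx] using this

theorem exists_isMul (g h : Arrow A B) (c : g.s = h.r) : ∃ k, IsMul g h k := by
  obtain ⟨q', q, hm, hx, hg, hh⟩ := exists_aligned g h c
  exact ⟨_, q', q, hm, hx, hg, hh, rfl⟩

theorem IsMul.unique {g h k k' : Arrow A B} (h1 : IsMul g h k) (h2 : IsMul g h k') : k = k' := by
  obtain ⟨p', p, hp, hpx, rfl, rfl, rfl⟩ := h1
  obtain ⟨q', q, hq, hqx, hg, hh, rfl⟩ := h2
  obtain ⟨a, b, hab⟩ := (Quad.mk_eq_iff B).1 hg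
  obtain ⟨c, d, hcd⟩ := (Quad.mk_eq_iff B).1 hh
  have l1 := congrArg (fun q => q.t.β.length) hab
  have l2 := congrArg (fun q => q.t.α.length) hcd
  simp only [Quad.iterate_β_length, Quad.iterate_α_length] at l1 l2
  have e1 : p'.t.β.length = p.t.α.length := by rw [hp]
  have e2 : q'.t.β.length = q.t.α.length := by rw [hq]
  refine (Quad.mk_eq_iff B).2 ⟨a + c, b + c, ?_⟩
  obtain ⟨h3, e3⟩ := Quad.iterate_comp B (a + c) p' p hp hpx
  obtain ⟨h4, e4⟩ := Quad.iterate_comp B (b + c) q' q hq hqx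
  have e5 : (Quad.next B)^[a + c] p' = (Quad.next B)^[b + c] q' := by
    rw [add_comm a, add_comm b, Function.iterate_add_apply, hab, ← Function.iterate_add_apply]
  have e6 : (Quad.next B)^[a + c] p = (Quad.next B)^[b + c] q := by
    rw [Function.iterate_add_apply, hcd, ← Function.iterate_add_apply]
    congr 1
    omega
  rw [e3, e4]
  simp only [e5, e6]

/-- The product, determined by
`[α, m', β; β κ_m(y)] · [β, m, γ; γ y] = [α, m' + m, γ; γ y]`. -/
noncomputable def mul (g h : Arrow A B) (c : g.s = h.r) : Arrow A B := (exists_isMul g h c).choose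

theorem mul_mk (q' q : Quad A) (hm : q'.t.β = q.t.α) (hx : q'.x = q.rng B) :
    mul (q'.mk' B) (q.mk' B) hx = (q'.comp q hm).mk' B :=
  (exists_isMul (q'.mk' B) (q.mk' B) hx).choose_spec.unique ⟨q', q, hm, hx, rfl, rfl, rfl⟩

/-- The set `Z(α, m, β; Z(β)) = {[α, m, β; x] : x ∈ Z(β)}`. -/
def basicSet (B : Matrix V V ℤ) (t : Triple A) : Set (Arrow A B) :=
  {g | ∃ (x : InfPath A) (hx : x ∈ t.β.Z), g = (Quad.mk t x hx).mk' B}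

/-- The topology with basis the sets `Z(α, m, β; Z(β))`. -/
instance : TopologicalSpace (Arrow A B) :=
  TopologicalSpace.generateFrom {S | ∃ t : Triple A, S = basicSet B t}

theorem isOpen_basicSet (t : Triple A) : IsOpen (basicSet B t) :=
  TopologicalSpace.isOpen_generateFrom_of_mem ⟨t, rfl⟩

theorem mk_mem_basicSet (q : Quad A) : q.mk' B ∈ basicSet B q.t := ⟨q.x, q.mem, rfl⟩

theorem basicSet_next (q : Quad A) : basicSet B (q.next B).t ⊆ basicSet B q.t := by
  rintro _ ⟨x, hx, rfl⟩
  obtain ⟨h1, h2⟩ := FinPath.mem_of_snoc_mem (FinPath.src_apply_of_mem q.mem) hx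
  exact ⟨x, h1, (Quot.sound ⟨rfl, _, _, rfl⟩).symm⟩

theorem basicSet_anti (q : Quad A) {n k : ℕ} (h : n ≤ k) :
    basicSet B ((Quad.next B)^[k] q).t ⊆ basicSet B ((Quad.next B)^[n] q).t := by
  induction k, h using Nat.le_induction with
  | base => exact subset_rfl
  | succ k _ ih =>
    rw [Function.iterate_succ_apply']
    exact (basicSet_next _).trans ih

theorem exists_basicSet {S : Set (Arrow A B)} (hS : IsOpen S) (q : Quad A) (hq : q.mk' B ∈ S) :
    ∃ n, basicSet B ((Quad.next B)^[n] q).t ⊆ S := by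
  induction hS with
  | basic S h =>
    obtain ⟨t, rfl⟩ := h
    obtain ⟨x, hx, e⟩ := hq
    obtain ⟨n, n', h⟩ := (Quad.mk_eq_iff B).1 e
    refine ⟨n, ?_⟩
    rw [h]
    exact basicSet_anti ⟨t, x, hx⟩ (Nat.zero_le n')
  | univ => exact ⟨0, Set.subset_univ _⟩
  | inter S T _ _ ihS ihT =>
    obtain ⟨n, hn⟩ := ihS hq.1
    obtain ⟨k, hk⟩ := ihT hq.2
    exact ⟨max n k, Set.subset_inter ((basicSet_anti q (le_max_left n k)).trans hn)
      ((basicSet_anti q (le_max_right n k)).trans hk)⟩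
  | sUnion 𝒮 _ ih =>
    obtain ⟨S, hS, hqS⟩ := hq
    obtain ⟨n, hn⟩ := ih S hS hqS
    exact ⟨n, hn.trans (Set.subset_sUnion_of_mem hS)⟩

theorem continuous_s : Continuous (s : Arrow A B → InfPath A) := by
  refine continuous_def.2 fun U hU => isOpen_iff_forall_mem_open.2 fun g hg => ?_
  obtain ⟨q, rfl⟩ := Quot.exists_rep g
  obtain ⟨n, hn⟩ := InfPath.exists_cylinder hU (x := q.x) hg
  refine ⟨basicSet B ((Quad.next B)^[n] q).t, ?_, isOpen_basicSet _, ?_⟩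
  · rintro _ ⟨x, hx, rfl⟩
    refine hn x fun i hi => ?_
    have h1 := ((FinPath.mem_Z_iff (((Quad.next B)^[n] q).mem)).1 hx).2 i
      (by rw [Quad.iterate_β_length]; omega)
    rwa [Quad.iterate_x] at h1
  · have := mk_mem_basicSet (B := B) ((Quad.next B)^[n] q)
    rwa [Quad.mk_iterate] at this

theorem image_s_basicSet (t : Triple A) : s '' (basicSet B t) = t.β.Z := by
  ext x
  constructor
  · rintro ⟨_, ⟨x, hx, rfl⟩, rfl⟩
    exact hx
  · intro hx
    exact ⟨_, ⟨x, hx, rfl⟩, rfl⟩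

theorem isOpenMap_s : IsOpenMap (s : Arrow A B → InfPath A) := by
  intro S hS
  refine isOpen_iff_forall_mem_open.2 ?_
  rintro _ ⟨g, hg, rfl⟩
  obtain ⟨q, rfl⟩ := Quot.exists_rep g
  obtain ⟨n, hn⟩ := exists_basicSet hS q hg
  refine ⟨_, Set.image_mono hn, ?_, ?_⟩
  · rw [image_s_basicSet]
    exact FinPath.isOpen_Z _
  · rw [image_s_basicSet]
    have := ((Quad.next B)^[n] q).mem
    rwa [Quad.iterate_x] at this

theorem isLocalHomeomorph_s : IsLocalHomeomorph (s : Arrow A B → InfPath A) := by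
  rw [isLocalHomeomorph_iff_isOpenEmbedding_restrict]
  intro g
  obtain ⟨q, rfl⟩ := Quot.exists_rep g
  refine ⟨basicSet B q.t, (isOpen_basicSet _).mem_nhds (mk_mem_basicSet q), ?_⟩
  refine Topology.IsOpenEmbedding.of_continuous_injective_isOpenMap
    (continuous_s.comp continuous_subtype_val) ?_ (isOpenMap_s.domRestrict (isOpen_basicSet _))
  rintro ⟨_, x, hx, rfl⟩ ⟨_, x', hx', rfl⟩ h
  obtain rfl : x = x' := h
  rfl

theorem continuous_one : Continuous (one : InfPath A → Arrow A B) := by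
  refine continuous_def.2 fun S hS => isOpen_iff_forall_mem_open.2 fun x hx => ?_
  obtain ⟨n, hn⟩ := exists_basicSet hS (Quad.unit x) hx
  obtain ⟨β, hβ, -, e⟩ := Quad.iterate_unit B n x
  refine ⟨β.Z, fun x' hx' => hn ?_, FinPath.isOpen_Z _, hβ⟩
  rw [e]
  exact ⟨x', hx', (Quad.mk_diag B β x' hx').symm⟩

theorem continuous_inv : Continuous (inv : Arrow A B → Arrow A B) := by
  refine continuous_def.2 fun S hS => isOpen_iff_forall_mem_open.2 fun g hg => ?_
  obtain ⟨q, rfl⟩ := Quot.exists_rep g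
  obtain ⟨n, hn⟩ := exists_basicSet hS (q.inv B) hg
  refine ⟨basicSet B ((Quad.next B)^[n] q).t, ?_, isOpen_basicSet _, ?_⟩
  · rintro _ ⟨x, hx, rfl⟩
    refine hn ?_
    rw [Quad.iterate_inv]
    exact ⟨_, _, rfl⟩
  · have := mk_mem_basicSet (B := B) ((Quad.next B)^[n] q)
    rwa [Quad.mk_iterate] at this

theorem continuous_mul : Continuous fun p : {p : Arrow A B × Arrow A B // s p.1 = r p.2} =>
    mul p.1.1 p.1.2 p.2 := by
  refine continuous_def.2 fun S hS => isOpen_iff_forall_mem_open.2 ?_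
  rintro ⟨⟨g, h⟩, c⟩ hp
  obtain ⟨q', q, hm, hx, rfl, rfl⟩ := exists_aligned g h c
  change mul _ _ _ ∈ S at hp
  rw [mul_mk q' q hm hx] at hp
  obtain ⟨n, hn⟩ := exists_basicSet hS _ hp
  obtain ⟨hm', e⟩ := Quad.iterate_comp B n q' q hm hx
  rw [e] at hn
  refine ⟨{p | p.1.1 ∈ basicSet B ((Quad.next B)^[n] q').t ∧
    p.1.2 ∈ basicSet B ((Quad.next B)^[n] q).t}, ?_, ?_, ?_, ?_⟩
  · rintro ⟨⟨_, _⟩, c⟩ ⟨⟨x', hx', rfl⟩, ⟨x, hx, rfl⟩⟩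
    refine hn ?_
    change mul _ _ _ ∈ _
    rw [mul_mk ⟨_, x', hx'⟩ ⟨_, x, hx⟩ hm' c]
    exact ⟨x, hx, rfl⟩
  · exact ((isOpen_basicSet _).preimage (by fun_prop)).inter
      ((isOpen_basicSet _).preimage (by fun_prop))
  · have := mk_mem_basicSet (B := B) ((Quad.next B)^[n] q')
    rwa [Quad.mk_iterate] at this
  · have := mk_mem_basicSet (B := B) ((Quad.next B)^[n] q)
    rwa [Quad.mk_iterate] at this

theorem continuous_ρ : Continuous (ρ : Arrow A B → ℤ) := by
  refine continuous_def.2 fun S _ => isOpen_iff_forall_mem_open.2 fun g hg => ?_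
  obtain ⟨q, rfl⟩ := Quot.exists_rep g
  refine ⟨basicSet B q.t, ?_, isOpen_basicSet _, mk_mem_basicSet q⟩
  rintro _ ⟨x, hx, rfl⟩
  exact hg

theorem ρ_mul (g h : Arrow A B) (c : g.s = h.r) : ρ (mul g h c) = ρ g + ρ h := by
  obtain ⟨q', q, hm, hx, rfl, rfl⟩ := exists_aligned g h c
  rw [mul_mk q' q hm hx]
  change (q'.t.α.length : ℤ) - q.t.β.length =
    ((q'.t.α.length : ℤ) - q'.t.β.length) + ((q.t.α.length : ℤ) - q.t.β.length)
  rw [hm]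
  ring

theorem s_mul (g h : Arrow A B) (c : g.s = h.r) : s (mul g h c) = s h := by
  obtain ⟨q', q, hm, hx, rfl, rfl⟩ := exists_aligned g h c
  rw [mul_mk q' q hm hx]
  rfl

theorem r_mul (g h : Arrow A B) (c : g.s = h.r) : r (mul g h c) = r g := by
  obtain ⟨q', q, hm, hx, rfl, rfl⟩ := exists_aligned g h c
  rw [mul_mk q' q hm hx]
  exact Quad.rng_comp B q' q hm hx

theorem s_one (x : InfPath A) : s (one x : Arrow A B) = x := rfl

theorem r_one (x : InfPath A) : r (one x : Arrow A B) = x := Quad.rng_unit B x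

theorem s_inv (g : Arrow A B) : s (inv g) = r g := by
  obtain ⟨q, rfl⟩ := Quot.exists_rep g
  rfl

theorem r_inv (g : Arrow A B) : r (inv g) = s g := by
  obtain ⟨q, rfl⟩ := Quot.exists_rep g
  exact Quad.rng_inv B q

theorem mul_congr {g g' h h' : Arrow A B} (hg : g = g') (hh : h = h') (c : g.s = h.r)
    (c' : g'.s = h'.r) : mul g h c = mul g' h' c' := by
  subst hg hh
  rfl

theorem one_mul (g : Arrow A B) : mul (one (r g)) g (s_one _) = g := by
  obtain ⟨q, rfl⟩ := Quot.exists_rep g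
  refine (mul_congr (Quad.mk_diag B q.t.α (q.rng B) (q.rng_mem B)).symm rfl _ rfl).trans ?_
  refine (mul_mk (Quad.diag q.t.α (q.rng B) (q.rng_mem B)) q rfl rfl).trans ?_
  refine congrArg (Quad.mk' B) (Quad.ext (Triple.ext rfl ?_ rfl) rfl)
  exact zero_add _

theorem mul_one (g : Arrow A B) : mul g (one (s g)) (r_one _).symm = g := by
  obtain ⟨q, rfl⟩ := Quot.exists_rep g
  have hx : q.x = (Quad.diag q.t.β q.x q.mem).rng B := (Quad.rng_diag B _ _ _).symm
  refine (mul_congr (g' := q.mk' B) rfl (Quad.mk_diag B q.t.β q.x q.mem).symm _ hx).trans ?_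
  refine (mul_mk q (Quad.diag q.t.β q.x q.mem) rfl hx).trans ?_
  refine congrArg (Quad.mk' B) (Quad.ext (Triple.ext rfl ?_ rfl) rfl)
  exact add_zero _

theorem inv_mul (g : Arrow A B) : mul (inv g) g (s_inv g) = one (s g) := by
  obtain ⟨q, rfl⟩ := Quot.exists_rep g
  refine (mul_mk (q.inv B) q rfl rfl).trans ?_
  refine Eq.trans ?_ (Quad.mk_diag B q.t.β q.x q.mem)
  refine congrArg (Quad.mk' B) (Quad.ext (Triple.ext rfl ?_ rfl) rfl)
  exact neg_add_cancel _

theorem mul_inv (g : Arrow A B) : mul g (inv g) (r_inv g).symm = one (r g) := by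
  obtain ⟨q, rfl⟩ := Quot.exists_rep g
  refine (mul_mk q (q.inv B) rfl (q.rng_inv B).symm).trans ?_
  refine Eq.trans ?_ (Quad.mk_diag B q.t.α (q.rng B) (q.rng_mem B))
  refine congrArg (Quad.mk' B) (Quad.ext (Triple.ext rfl ?_ rfl) rfl)
  exact add_neg_cancel _

theorem mul_assoc (g h k : Arrow A B) (c : g.s = h.r) (d : h.s = k.r) :
    mul (mul g h c) k ((s_mul g h c).trans d) = mul g (mul h k d) (c.trans (r_mul h k d).symm) := by
  obtain ⟨p, q, hm, hx, rfl, rfl⟩ := exists_aligned g h c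
  obtain ⟨w, rfl⟩ := Quot.exists_rep k
  have hd : q.x = w.rng B := d
  -- extend all three representatives so that the middle paths match
  obtain ⟨hpq, -⟩ := Quad.iterate_comp B w.t.α.length p q hm hx
  have hqw : ((Quad.next B)^[w.t.α.length] q).t.β = ((Quad.next B)^[q.t.β.length] w).t.α := by
    refine FinPath.eq_of_mem (Quad.mem _) ?_ (by simp [add_comm])
    have := Quad.rng_mem B ((Quad.next B)^[q.t.β.length] w)
    simpa [hd] using this
  generalize hp' : (Quad.next B)^[w.t.α.length] p = p' at *
  generalize hq' : (Quad.next B)^[w.t.α.length] q = q' at *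
  generalize hw' : (Quad.next B)^[q.t.β.length] w = w' at *
  have ep : p.mk' B = p'.mk' B := by rw [← hp', Quad.mk_iterate]
  have eq : q.mk' B = q'.mk' B := by rw [← hq', Quad.mk_iterate]
  have ew : Quot.mk (Step B) w = w'.mk' B := by rw [← hw', Quad.mk_iterate]; rfl
  have hx' : p'.x = q'.rng B := by rw [← hp', ← hq']; simpa using hx
  have hd' : q'.x = w'.rng B := by rw [← hq', ← hw']; simpa using hd
  have e1 : mul (p.mk' B) (q.mk' B) c = (p'.comp q' hpq).mk' B :=
    (mul_congr ep eq c hx').trans (mul_mk p' q' hpq hx')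
  have e2 : mul (q.mk' B) (Quot.mk (Step B) w) d = (q'.comp w' hqw).mk' B :=
    (mul_congr eq ew d hd').trans (mul_mk q' w' hqw hd')
  have hx2 : p'.x = (q'.comp w' hqw).rng B := by rw [Quad.rng_comp B _ _ _ hd', hx']
  refine (mul_congr e1 ew _ hd').trans ?_
  refine (mul_mk (p'.comp q' hpq) w' hqw hd').trans ?_
  refine Eq.trans ?_ (mul_congr ep e2 _ hx2).symm
  refine Eq.trans ?_ (mul_mk p' (q'.comp w' hqw) hpq hx2).symm
  refine congrArg (Quad.mk' B) (Quad.ext (Triple.ext rfl ?_ rfl) rfl)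
  exact add_assoc _ _ _

end Arrow

/-- The Katsura–Exel–Pardo groupoid `𝒢_{A,B}`. -/
noncomputable def groupoid (A B : Matrix V V ℤ) : EtaleGroupoid (Arrow A B) (InfPath A) where
  s := Arrow.s
  r := Arrow.r
  one := Arrow.one
  mul := Arrow.mul
  inv := Arrow.inv
  s_one := Arrow.s_one
  r_one := Arrow.r_one
  s_mul := Arrow.s_mul
  r_mul := Arrow.r_mul
  s_inv := Arrow.s_inv
  r_inv := Arrow.r_inv
  one_mul := Arrow.one_mul
  mul_one := Arrow.mul_one
  mul_assoc := Arrow.mul_assoc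
  inv_mul := Arrow.inv_mul
  mul_inv := Arrow.mul_inv
  continuous_one := Arrow.continuous_one
  continuous_inv := Arrow.continuous_inv
  continuous_mul := Arrow.continuous_mul
  isLocalHomeomorph_s := Arrow.isLocalHomeomorph_s

/-- The kernel `ℋ_{A,B}` of the length cocycle `ρ`. -/
noncomputable def kerGroupoid (A B : Matrix V V ℤ) :
    EtaleGroupoid {g : Arrow A B // Arrow.ρ g = 0} (InfPath A) :=
  (groupoid A B).ker Arrow.ρ Arrow.ρ_mul Arrow.continuous_ρ

/-- The subset `Z(α, m, α; Z(α))` of `ℋ_{A,B}`. -/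
def diagSet (A B : Matrix V V ℤ) (α : FinPath A) (m : ℤ) : Set {g : Arrow A B // Arrow.ρ g = 0} :=
  {g | g.1 ∈ Arrow.basicSet B ⟨α, m, α, rfl⟩}

/-! ### The inductive limit `ℤ_B` -/

/-- The endomorphism `1_v ↦ ∑_w B_{v,w} 1_w` of the free abelian group on the vertices. -/
noncomputable def connecting (hB : RowFinite B) : Module.End ℤ (V →₀ ℤ) :=
  Finsupp.linearCombination ℤ fun v => Finsupp.ofSupportFinite (B v) (hB v)

/-- `ℤ_B`, the inductive limit of the free abelian groups on the vertices, indexed by `n ∈ ℕ`,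
with all connecting maps from stage `n` to stage `n + 1` equal to `connecting B`. -/
abbrev IndLimit (hB : RowFinite B) : Type _ :=
  Module.DirectLimit (R := ℤ) (ι := ℕ) (fun _ => V →₀ ℤ)
    (fun i j _ => connecting B hB ^ (j - i))

/-- The canonical map `φ^B_{n,∞}` from stage `n` to the inductive limit. -/
noncomputable def toLimit (hB : RowFinite B) (n : ℕ) : (V →₀ ℤ) →ₗ[ℤ] IndLimit B hB :=
  Module.DirectLimit.of ℤ ℕ (fun _ => V →₀ ℤ) (fun i j _ => connecting B hB ^ (j - i)) n

end Katsura

/-!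
Cut every path, every arrow and every composable pair at level `n`, that is, represent the arrows
by triples `(α, m, β)` with `|α| = |β| = n`. Since each of the three spaces has a basis of compact
open sets which at each level are pairwise disjoint, a compactly supported function is, from some
level on, a unique linear combination of indicator functions of that level (pseudo freeness makes
the sets `Z(α, m, β; Z(β))` disjoint), and `δ₁` and `δ₂` preserve the level.

At level `n` the sets `Z(α, m, β; Z(β))` form the discrete groupoid
`{(α, β) : |α| = |β| = n, r(α) = r(β)} × ℤ`, with one orbit for each vertex `v` that is the range of
a path of length `n`, and isotropy group `ℤ` there. Its first homology is therefore the free abelian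
group on these vertices, through `(α, m, β) ↦ m 1_{r(β)}`. Writing `Z(α, m, β; Z(β))` as the union
of the sets `Z(α κ_m(e), φ(m, e), β e; Z(β e))` turns `m 1_v` into `∑_e φ(m, e) 1_{r(e)}`, and since
`e ↦ κ_m(e)` permutes the edges from `v` to `w`, adding up the equations
`m B_{v,w} + i = φ(m, e) A_{v,w} + l` for `0 ≤ i < A_{v,w}` gives `∑_e φ(m, e) = m B_{v,w}`. So the
passage to the next level is the connecting map of `ℤ_B`.

The vertices that are not ranges of paths of length `n` do not matter in the limit. If every vertex
receives an edge, there are none. If there are finitely many vertices, the decreasing sequence of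
the sets of ranges becomes stationary, at `n = K` say, and since the support of `B` is contained in
that of `A`, the image of the `K`-th power of the connecting map is supported on this set.
-/

section Indicator

variable {X : Type*} [TopologicalSpace X]

/-- The indicator function of a compact open and closed set `U`, as a compactly supported
continuous function. -/
noncomputable def clopenIndicator (R : Type*) [Zero R] [One R] [TopologicalSpace R] {U : Set X}
    (hU : IsClopen U) (hc : IsCompact U) : C_c(X, R) where
  toFun := U.indicator 1
  continuous_toFun := (continuous_const (y := (1 : R))).indicator (by simp [hU.frontier_eq])
  hasCompactSupport' :=
    hc.of_isClosed_subset (isClosed_tsupport _)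
      (closure_minimal Set.support_indicator_subset hU.isClosed)

theorem coe_clopenIndicator {R : Type*} [Zero R] [One R] [TopologicalSpace R] {U : Set X}
    (hU : IsClopen U) (hc : IsCompact U) : ⇑(clopenIndicator R hU hc) = U.indicator 1 := rfl

theorem pushforward_eq_indicator {Y : Type*} {π : X → Y} (hπ : IsLocallyInjective π)
    {f : C_c(X, ℤ)} {U : Set X} {W : Set Y} (hf : ⇑f = U.indicator 1) (hUW : Set.BijOn π U W) :
    pushforward π hπ f = W.indicator 1 := by
  ext y
  change ∑ᶠ x : {x : X // π x = y}, f x = _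
  by_cases hy : y ∈ W
  · obtain ⟨x, hx, rfl⟩ := hUW.surjOn hy
    rw [finsum_eq_single _ ⟨x, rfl⟩]
    · simp [hf, hx, hy]
    · rintro ⟨x', hx'⟩ hne
      have : x' ∉ U := fun h => hne (Subtype.ext (hUW.injOn h hx hx'))
      simp [hf, this]
  · rw [finsum_eq_zero_of_forall_eq_zero]
    · simp [hy]
    · rintro ⟨x, rfl⟩
      have : x ∉ U := fun h => hy (hUW.mapsTo h)
      simp [hf, this]

end Indicator

/-- A basis of nonempty compact open sets `U n i` arranged in levels `n`: the members of one level
are pairwise disjoint, and each member of a level is covered by the members of any later level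
contained in it. A compactly supported function with values in a discrete group is then a
combination of the indicator functions of any sufficiently late level. -/
structure IsLevelBasis {X L : Type*} [TopologicalSpace X] [Preorder L] {ι : L → Type*}
    (U : ∀ n, ι n → Set X) : Prop where
  isOpen : ∀ n i, IsOpen (U n i)
  isCompact : ∀ n i, IsCompact (U n i)
  nonempty : ∀ n i, (U n i).Nonempty
  eq_of_mem : ∀ {n i j x}, x ∈ U n i → x ∈ U n j → i = j
  exists_subset : ∀ {n k i x}, n ≤ k → x ∈ U n i → ∃ j, x ∈ U k j ∧ U k j ⊆ U n i
  exists_mem : ∀ {W : Set X} {x}, IsOpen W → x ∈ W → ∃ n i, x ∈ U n i ∧ U n i ⊆ W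

namespace IsLevelBasis

open Filter

variable {X L : Type*} [TopologicalSpace X] [Preorder L] {ι : L → Type*} {U : ∀ n, ι n → Set X}

theorem subset_of_mem (hU : IsLevelBasis U) {n k : L} {i : ι n} {j : ι k} {x : X} (h : n ≤ k)
    (hi : x ∈ U n i) (hj : x ∈ U k j) : U k j ⊆ U n i := by
  obtain ⟨j', hj', hsub⟩ := hU.exists_subset h hi
  rwa [hU.eq_of_mem hj hj']

section Directed

variable [IsDirectedOrder L]

theorem isClopen (hU : IsLevelBasis U) (n : L) (i : ι n) : IsClopen (U n i) := by
  refine ⟨⟨isOpen_iff_forall_mem_open.2 fun x hx => ?_⟩, hU.isOpen n i⟩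
  obtain ⟨m, j, hj, -⟩ := hU.exists_mem isOpen_univ (Set.mem_univ x)
  obtain ⟨k, hnk, hmk⟩ := exists_ge_ge n m
  obtain ⟨j', hj', -⟩ := hU.exists_subset hmk hj
  refine ⟨U k j', fun y hy hyi => hx ?_, hU.isOpen k j', hj'⟩
  exact hU.subset_of_mem hnk hyi hy hj'

theorem eventually_exists_eq_on [Nonempty L] (hU : IsLevelBasis U) {Y : Type*} [TopologicalSpace Y]
    [DiscreteTopology Y] {f : X → Y} (hf : Continuous f) {K : Set X} (hK : IsCompact K) :
    ∀ᶠ k in atTop, ∀ x ∈ K, ∃ j, x ∈ U k j ∧ ∀ y ∈ U k j, f y = f x := by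
  refine hK.induction_on (p := fun S => ∀ᶠ k in atTop, ∀ x ∈ S, ∃ j, x ∈ U k j ∧
    ∀ y ∈ U k j, f y = f x) (by simp)
    (fun S T hST hT => hT.mono fun k hk x hx => hk x (hST hx)) ?_ ?_
  · intro S T hS hT
    filter_upwards [hS, hT] with k hkS hkT x hx
    exact hx.elim (hkS x) (hkT x)
  · intro x _
    obtain ⟨n, i, hi, hsub⟩ :=
      hU.exists_mem (W := f ⁻¹' {f x}) ((isOpen_discrete _).preimage hf) rfl
    refine ⟨U n i, mem_nhdsWithin_of_mem_nhds ((hU.isOpen n i).mem_nhds hi), ?_⟩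
    filter_upwards [eventually_ge_atTop n] with k hk y hy
    obtain ⟨j, hj, hji⟩ := hU.exists_subset hk hy
    exact ⟨j, hj, fun z hz => (hsub (hji hz)).trans (hsub hy).symm⟩

end Directed

theorem finite_setOf_inter_nonempty (hU : IsLevelBasis U) {K : Set X} (hK : IsCompact K) {n : L}
    (hcov : K ⊆ ⋃ i, U n i) : {i | (U n i ∩ K).Nonempty}.Finite := by
  obtain ⟨s, hs⟩ := hK.elim_finite_subcover (U n) (hU.isOpen n) hcov
  refine s.finite_toSet.subset ?_
  rintro i ⟨x, hxi, hxK⟩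
  obtain ⟨j, hj, hxj⟩ := Set.mem_iUnion₂.1 (hs hxK)
  rwa [hU.eq_of_mem hxi hxj]

section Realize

variable [IsDirectedOrder L] (R : Type*) [Ring R] [TopologicalSpace R] [IsTopologicalRing R]

/-- The linear combinations of the indicator functions of the members of level `n`. -/
noncomputable def realize (hU : IsLevelBasis U) (n : L) : (ι n →₀ R) →ₗ[R] C_c(X, R) :=
  Finsupp.linearCombination R fun i => clopenIndicator R (hU.isClopen n i) (hU.isCompact n i)

variable {R}

theorem realize_single_one (hU : IsLevelBasis U) (n : L) (i : ι n) :
    hU.realize R n (Finsupp.single i 1) =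
      clopenIndicator R (hU.isClopen n i) (hU.isCompact n i) := by
  simp [realize]

theorem realize_apply (hU : IsLevelBasis U) {n : L} (a : ι n →₀ R) (x : X) :
    hU.realize R n a x = a.sum fun i c => c * (U n i).indicator 1 x := by
  simp [realize, Finsupp.linearCombination_apply, Finsupp.sum, coe_clopenIndicator,
    CompactlySupportedContinuousMap.sum_apply]

theorem realize_apply_of_mem (hU : IsLevelBasis U) {n : L} {i : ι n} {x : X} (hx : x ∈ U n i)
    (a : ι n →₀ R) : hU.realize R n a x = a i := by
  rw [realize_apply, Finsupp.sum_eq_single i]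
  · simp [hx]
  · intro j _ hji
    simp [mt (hU.eq_of_mem hx) hji.symm]
  · simp

theorem realize_apply_of_notMem (hU : IsLevelBasis U) {n : L} {x : X} (hx : ∀ i, x ∉ U n i)
    (a : ι n →₀ R) : hU.realize R n a x = 0 := by
  simp [realize_apply, hx]

theorem realize_injective (hU : IsLevelBasis U) (n : L) :
    Function.Injective (hU.realize R n) := by
  intro a b h
  ext i
  obtain ⟨x, hx⟩ := hU.nonempty n i
  rw [← hU.realize_apply_of_mem hx, h, hU.realize_apply_of_mem hx]

theorem exists_realize_eq (hU : IsLevelBasis U) {n : L} {f : C_c(X, R)}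
    (hf : ∀ x ∈ tsupport f, ∃ j, x ∈ U n j ∧ ∀ y ∈ U n j, f y = f x) :
    ∃ a, hU.realize R n a = f := by
  have hfin : {i | (U n i ∩ tsupport f).Nonempty}.Finite :=
    hU.finite_setOf_inter_nonempty f.hasCompactSupport fun x hx =>
      Set.mem_iUnion.2 ((hf x hx).imp fun _ => And.left)
  have hconst : ∀ {i x y}, x ∈ U n i → y ∈ U n i → f x ≠ 0 → f y = f x := by
    intro i x y hx hy hfx
    obtain ⟨j, hxj, hj⟩ := hf x (subset_tsupport _ hfx)
    exact hj y (hU.eq_of_mem hx hxj ▸ hy)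
  let v : ι n → R := fun i => f (hU.nonempty n i).some
  refine ⟨Finsupp.onFinset hfin.toFinset v fun i hi => ?_, ?_⟩
  · exact hfin.mem_toFinset.2 ⟨_, (hU.nonempty n i).some_mem, subset_tsupport _ hi⟩
  · ext x
    by_cases hx : ∃ i, x ∈ U n i
    · obtain ⟨i, hi⟩ := hx
      rw [hU.realize_apply_of_mem hi, Finsupp.onFinset_apply]
      by_cases hfx : f x = 0
      · by_contra h
        exact h (hconst (hU.nonempty n i).some_mem hi (hfx ▸ h)).symm
      · exact hconst hi (hU.nonempty n i).some_mem hfx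
    · rw [hU.realize_apply_of_notMem (not_exists.1 hx)]
      by_contra h
      exact hx ((hf x (subset_tsupport _ (Ne.symm h))).imp fun _ => And.left)

theorem realize_sum_single_one (hU : IsLevelBasis U) {n k : L} {i : ι n} {s : Finset (ι k)}
    (hs : ∀ x, x ∈ U n i ↔ ∃ j ∈ s, x ∈ U k j) :
    hU.realize R k (∑ j ∈ s, Finsupp.single j 1) = hU.realize R n (Finsupp.single i 1) := by
  classical
  ext x
  by_cases hx : x ∈ U n i
  · obtain ⟨j, hj, hxj⟩ := (hs x).1 hx
    rw [hU.realize_apply_of_mem hx, hU.realize_apply_of_mem hxj]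
    simp [Finsupp.single_apply, hj]
  · have hx' : ∀ j ∈ s, x ∉ U k j := by simpa using mt (hs x).2 hx
    simp only [map_sum, realize_single_one, CompactlySupportedContinuousMap.sum_apply,
      coe_clopenIndicator, Set.indicator_of_notMem hx]
    exact Finset.sum_eq_zero fun j hj => Set.indicator_of_notMem (hx' j hj) _

variable [DiscreteTopology R] [Nonempty L]

theorem eventually_exists_realize (hU : IsLevelBasis U) (f : C_c(X, R)) :
    ∀ᶠ n in atTop, ∃ a, hU.realize R n a = f :=
  (hU.eventually_exists_eq_on f.continuous f.hasCompactSupport).mono fun _ => hU.exists_realize_eq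

/-- A family of linear maps on the levels, compatible with the equality of the functions they
represent, extended to all compactly supported functions. -/
noncomputable def lift (hU : IsLevelBasis U) {P : Type*} [AddCommGroup P] [Module R P]
    (g : ∀ n, (ι n →₀ R) →ₗ[R] P)
    (hg : ∀ {n k a b}, hU.realize R n a = hU.realize R k b → g n a = g k b) : C_c(X, R) →ₗ[R] P :=
  have hex f : ∃ n a, hU.realize R n a = f := (hU.eventually_exists_realize f).exists
  { toFun f := g _ (hex f).choose_spec.choose
    map_add' f f' := by
      obtain ⟨n, ⟨a, ha⟩, b, hb⟩ :=
        ((hU.eventually_exists_realize f).and (hU.eventually_exists_realize f')).exists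
      have key {f n a} (h : hU.realize R n a = f) : g _ (hex f).choose_spec.choose = g n a :=
        hg ((hex f).choose_spec.choose_spec.trans h.symm)
      rw [key ha, key hb, key (show hU.realize R n (a + b) = f + f' by rw [map_add, ha, hb]),
        map_add]
    map_smul' c f := by
      rw [RingHom.id_apply, ← map_smul]
      refine hg ?_
      rw [map_smul, (hex f).choose_spec.choose_spec, (hex (c • f)).choose_spec.choose_spec] }

theorem lift_realize (hU : IsLevelBasis U) {P : Type*} [AddCommGroup P] [Module R P]
    {g : ∀ n, (ι n →₀ R) →ₗ[R] P}
    (hg : ∀ {n k a b}, hU.realize R n a = hU.realize R k b → g n a = g k b) (n : L)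
    (a : ι n →₀ R) : hU.lift g hg (hU.realize R n a) = g n a :=
  hg (hU.eventually_exists_realize (hU.realize R n a)).exists.choose_spec.choose_spec

end Realize

end IsLevelBasis

theorem isCompact_of_isLocalHomeomorph_of_injOn {X Y : Type*} [TopologicalSpace X]
    [TopologicalSpace Y] {f : X → Y} (hf : IsLocalHomeomorph f) {U : Set X} (hU : IsOpen U)
    (hinj : Set.InjOn f U) (hc : IsCompact (f '' U)) : IsCompact U := by
  have hemb : Topology.IsOpenEmbedding (U.domRestrict f) :=
    (hf.comp hU.isOpenEmbedding_subtypeVal.isLocalHomeomorph).isOpenEmbedding_of_injective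
      (Set.injOn_iff_injective.1 hinj)
  rw [isCompact_iff_isCompact_univ, hemb.isInducing.isCompact_iff, Set.image_univ,
    Set.range_domRestrict]
  exact hc

namespace EtaleGroupoid

variable {G X : Type*} [TopologicalSpace G] [TopologicalSpace X] (𝒢 : EtaleGroupoid G X)

theorem continuous_s : Continuous 𝒢.s := 𝒢.isLocalHomeomorph_s.continuous

theorem continuous_r : Continuous 𝒢.r := by
  rw [show 𝒢.r = 𝒢.s ∘ 𝒢.inv from funext fun g => (𝒢.s_inv g).symm]
  exact 𝒢.continuous_s.comp 𝒢.continuous_inv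

/-- The composable pairs `(g, h)` with `g ∈ U` and `h ∈ W`. -/
def pairsIn (U W : Set G) : Set 𝒢.Pairs := {p | p.1.1 ∈ U ∧ p.1.2 ∈ W}

variable {𝒢} {U W : Set G}

theorem isOpen_pairsIn (hU : IsOpen U) (hW : IsOpen W) : IsOpen (𝒢.pairsIn U W) :=
  (hU.prod hW).preimage continuous_subtype_val

theorem isCompact_pairsIn [T2Space X] (hU : IsCompact U) (hW : IsCompact W) :
    IsCompact (𝒢.pairsIn U W) :=
  (isClosed_eq (𝒢.continuous_s.comp continuous_fst)
    (𝒢.continuous_r.comp continuous_snd)).isClosedEmbedding_subtypeVal.isCompact_preimage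
      (hU.prod hW)

theorem bijOn_d₀_pairsIn (hs : Set.InjOn 𝒢.s U) (h : Set.MapsTo 𝒢.r W (𝒢.s '' U)) :
    Set.BijOn 𝒢.d₀ (𝒢.pairsIn U W) W := by
  refine ⟨fun p hp => hp.2, ?_, fun w hw => ?_⟩
  · rintro ⟨⟨g, k⟩, c⟩ hp ⟨⟨g', k'⟩, c'⟩ hp' (rfl : k = k')
    obtain rfl : g = g' := hs hp.1 hp'.1 (c.trans c'.symm)
    rfl
  · obtain ⟨u, hu, huw⟩ := h hw
    exact ⟨⟨(u, w), huw⟩, ⟨hu, hw⟩, rfl⟩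

theorem bijOn_d₂_pairsIn (hr : Set.InjOn 𝒢.r W) (h : Set.MapsTo 𝒢.s U (𝒢.r '' W)) :
    Set.BijOn 𝒢.d₂ (𝒢.pairsIn U W) U := by
  refine ⟨fun p hp => hp.1, ?_, fun u hu => ?_⟩
  · rintro ⟨⟨g, k⟩, c⟩ hp ⟨⟨g', k'⟩, c'⟩ hp' (rfl : g = g')
    obtain rfl : k = k' := hr hp.2 hp'.2 (c.symm.trans c')
    rfl
  · obtain ⟨w, hw, hwu⟩ := h hu
    exact ⟨⟨(u, w), hwu.symm⟩, ⟨hu, hw⟩, rfl⟩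

theorem injOn_d₁_pairsIn (hr : Set.InjOn 𝒢.r U) (hs : Set.InjOn 𝒢.s W) :
    Set.InjOn 𝒢.d₁ (𝒢.pairsIn U W) := by
  rintro ⟨⟨g, k⟩, c⟩ hp ⟨⟨g', k'⟩, c'⟩ hp' (hm : 𝒢.mul g k c = 𝒢.mul g' k' c')
  obtain rfl : g = g' := hr hp.1 hp'.1 (by rw [← 𝒢.r_mul g k c, hm, 𝒢.r_mul])
  obtain rfl : k = k' := hs hp.2 hp'.2 (by rw [← 𝒢.s_mul g k c, hm, 𝒢.s_mul])
  rfl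

theorem δ₁_eq_sub_indicator {f : C_c(G, ℤ)} (hf : ⇑f = U.indicator 1) {S T : Set X}
    (hs : Set.BijOn 𝒢.s U S) (hr : Set.BijOn 𝒢.r U T) :
    𝒢.δ₁ f = S.indicator 1 - T.indicator 1 := by
  rw [δ₁, AddMonoidHom.sub_apply, pushforward_eq_indicator _ hf hs,
    pushforward_eq_indicator _ hf hr]

theorem δ₂_eq_indicator {f : C_c(𝒢.Pairs, ℤ)} (hf : ⇑f = (𝒢.pairsIn U W).indicator 1) {S : Set X}
    (hsU : Set.BijOn 𝒢.s U S) (hrW : Set.BijOn 𝒢.r W S) (hrU : Set.InjOn 𝒢.r U)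
    (hsW : Set.InjOn 𝒢.s W) :
    𝒢.δ₂ f = W.indicator 1 - (𝒢.d₁ '' 𝒢.pairsIn U W).indicator 1 + U.indicator 1 := by
  have h₀ := bijOn_d₀_pairsIn hsU.injOn (hsU.image_eq ▸ hrW.mapsTo)
  have h₁ := (injOn_d₁_pairsIn hrU hsW).bijOn_image
  have h₂ := bijOn_d₂_pairsIn hrW.injOn (hrW.image_eq ▸ hsU.mapsTo)
  rw [δ₂, AddMonoidHom.add_apply, AddMonoidHom.sub_apply, pushforward_eq_indicator _ hf h₀,
    pushforward_eq_indicator _ hf h₁, pushforward_eq_indicator _ hf h₂]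

end EtaleGroupoid

theorem IsLevelBasis.pairs {G X L : Type*} [TopologicalSpace G] [TopologicalSpace X] [T2Space X]
    [Preorder L] [IsDirectedOrder L] (𝒢 : EtaleGroupoid G X) {ι : L → Type*}
    {U : ∀ n, ι n → Set G} (hU : IsLevelBasis U) {C : ∀ n, ι n × ι n → Prop}
    (hC : ∀ n p, C n p ↔ (𝒢.pairsIn (U n p.1) (U n p.2)).Nonempty) :
    IsLevelBasis fun n (p : {p // C n p}) => 𝒢.pairsIn (U n p.1.1) (U n p.1.2) where
  isOpen n p := EtaleGroupoid.isOpen_pairsIn (hU.isOpen n _) (hU.isOpen n _)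
  isCompact n p := EtaleGroupoid.isCompact_pairsIn (hU.isCompact n _) (hU.isCompact n _)
  nonempty n p := (hC n p.1).1 p.2
  eq_of_mem hi hj :=
    Subtype.ext (Prod.ext (hU.eq_of_mem hi.1 hj.1) (hU.eq_of_mem hi.2 hj.2))
  exists_subset {n k p x} hnk hx := by
    obtain ⟨i, hi, his⟩ := hU.exists_subset hnk hx.1
    obtain ⟨j, hj, hjs⟩ := hU.exists_subset hnk hx.2
    exact ⟨⟨(i, j), (hC k _).2 ⟨x, hi, hj⟩⟩, ⟨hi, hj⟩, fun y hy => ⟨his hy.1, hjs hy.2⟩⟩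
  exists_mem {S x} hS hx := by
    obtain ⟨S, hS, rfl⟩ := hS
    obtain ⟨W₁, W₂, hW₁, hW₂, hx₁, hx₂, hsub⟩ := isOpen_prod_iff.1 hS x.1.1 x.1.2 hx
    obtain ⟨n₁, i₁, hi₁, his₁⟩ := hU.exists_mem hW₁ hx₁
    obtain ⟨n₂, i₂, hi₂, his₂⟩ := hU.exists_mem hW₂ hx₂
    obtain ⟨k, hk₁, hk₂⟩ := exists_ge_ge n₁ n₂
    obtain ⟨i, hi, his⟩ := hU.exists_subset hk₁ hi₁
    obtain ⟨j, hj, hjs⟩ := hU.exists_subset hk₂ hi₂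
    exact ⟨k, ⟨(i, j), (hC k _).2 ⟨x, hi, hj⟩⟩, ⟨hi, hj⟩,
      fun y hy => hsub ⟨his₁ (his hy.1), his₂ (hjs hy.2)⟩⟩

namespace Katsura

variable {V : Type*} {A B : Matrix V V ℤ}

section Paths

theorem Edge.sum_idx_act (m : ℤ) (B : Matrix V V ℤ) {S : Finset (Edge A)}
    (hS : ∀ k, ∀ e ∈ S, e.act B k ∈ S) : ∑ e ∈ S, (e.act B m).idx = ∑ e ∈ S, e.idx :=
  Finset.sum_nbij' (Edge.act B m) (Edge.act B (-m)) (hS m) (hS (-m))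
    (fun e _ => by rw [← Edge.act_add, neg_add_cancel, Edge.act_zero])
    (fun e _ => by rw [← Edge.act_add, add_neg_cancel, Edge.act_zero]) (fun _ _ => rfl)

variable (A) in
/-- The finite set of edges from `v` to `w`. -/
noncomputable def edgesBetween (v w : V) : Finset (Edge A) :=
  (Finset.Ico 0 (A v w)).attach.map
    ⟨fun i => ⟨v, w, i.1, (Finset.mem_Ico.1 i.2).1, (Finset.mem_Ico.1 i.2).2⟩,
      fun _ _ h => Subtype.ext (congrArg Edge.idx h)⟩

@[simp] theorem mem_edgesBetween {v w : V} {e : Edge A} :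
    e ∈ edgesBetween A v w ↔ e.src = v ∧ e.tgt = w := by
  simp only [edgesBetween, Finset.mem_map, Finset.mem_attach, true_and]
  constructor
  · rintro ⟨i, rfl⟩
    exact ⟨rfl, rfl⟩
  · rintro ⟨rfl, rfl⟩
    exact ⟨⟨e.idx, Finset.mem_Ico.2 ⟨e.idx_nonneg, e.idx_lt⟩⟩, rfl⟩

theorem card_edgesBetween (v w : V) : (edgesBetween A v w).card = (A v w).toNat := by
  simp [edgesBetween]

theorem sum_cocycle_edgesBetween {v w : V} (hA : 0 ≤ A v w) (hAB : A v w = 0 → B v w = 0) (m : ℤ) :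
    ∑ e ∈ edgesBetween A v w, e.cocycle B m = m * B v w := by
  rcases hA.eq_or_lt with h0 | hpos
  · have hempty : edgesBetween A v w = ∅ :=
      Finset.card_eq_zero.1 (by rw [card_edgesBetween, ← h0, Int.toNat_zero])
    rw [hempty, Finset.sum_empty, hAB h0.symm, mul_zero]
  have hdiv : ∀ e ∈ edgesBetween A v w,
      A v w * e.cocycle B m = m * B v w + (e.idx - (e.act B m).idx) := by
    intro e he
    obtain ⟨rfl, rfl⟩ := mem_edgesBetween.1 he
    rw [Edge.cocycle, Edge.act_idx]
    linear_combination Int.emod_add_mul_ediv (m * B e.src e.tgt + e.idx) (A e.src e.tgt)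
  have hperm := Edge.sum_idx_act m B (S := edgesBetween A v w) fun k e he =>
    mem_edgesBetween.2 (mem_edgesBetween.1 he :)
  refine mul_left_cancel₀ hpos.ne' ?_
  rw [Finset.mul_sum, Finset.sum_congr rfl hdiv, Finset.sum_add_distrib, Finset.sum_sub_distrib,
    hperm, sub_self, add_zero, Finset.sum_const, card_edgesBetween, nsmul_eq_mul,
    Int.toNat_of_nonneg hA]

theorem finite_setOf_src_eq (hA : RowFinite A) (v : V) : {e : Edge A | e.src = v}.Finite := by
  refine ((hA v).biUnion fun w _ => (edgesBetween A v w).finite_toSet).subset ?_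
  rintro e rfl
  exact Set.mem_iUnion₂.2 ⟨e.tgt, e.pos.ne', by simp⟩

/-- The edges which may occur in position `i` of a path starting at `v`. -/
def reachable (A : Matrix V V ℤ) (v : V) : ℕ → Set (Edge A)
  | 0 => {e | e.src = v}
  | i + 1 => ⋃ f ∈ reachable A v i, {e | e.src = f.tgt}

theorem finite_reachable (hA : RowFinite A) (v : V) (i : ℕ) : (reachable A v i).Finite := by
  induction i with
  | zero => exact finite_setOf_src_eq hA v
  | succ i ih => exact ih.biUnion fun f _ => finite_setOf_src_eq hA f.tgt

theorem InfPath.apply_mem_reachable (x : InfPath A) (i : ℕ) : x.1 i ∈ reachable A x.src i := by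
  induction i with
  | zero => rfl
  | succ i ih => exact Set.mem_iUnion₂.2 ⟨x.1 i, ih, (x.2 i).symm⟩

theorem isClosed_setOf_tgt_eq_src :
    IsClosed {x : ℕ → Edge A | ∀ i, (x i).tgt = (x (i + 1)).src} := by
  simp only [Set.ofPred_forall]
  refine isClosed_iInter fun i => ?_
  have : Continuous fun x : ℕ → Edge A => (x i, x (i + 1)) := by fun_prop
  exact (isClosed_discrete {p : Edge A × Edge A | p.1.tgt = p.2.src}).preimage this

theorem InfPath.isCompact_setOf_src_eq (hA : RowFinite A) (v : V) :
    IsCompact {x : InfPath A | x.src = v} := by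
  have h : {x : InfPath A | x.src = v} =
      Subtype.val ⁻¹' (Set.pi Set.univ (reachable A v)) := by
    ext x
    refine ⟨?_, fun hx => hx 0 (Set.mem_univ _)⟩
    rintro rfl i -
    exact x.apply_mem_reachable i
  rw [h]
  exact isClosed_setOf_tgt_eq_src.isClosedEmbedding_subtypeVal.isCompact_preimage
    (isCompact_univ_pi fun i => (finite_reachable hA v i).isCompact)

theorem FinPath.isCompact_Z (hA : RowFinite A) (α : FinPath A) : IsCompact α.Z := by
  rcases α.Z.eq_empty_or_nonempty with h | ⟨x, hx⟩
  · exact h ▸ isCompact_empty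
  have h : α.Z = {x' | x'.src = x.src} ∩ ⋂ i ∈ Set.Iio α.length, {x' | x'.1 i = x.1 i} := by
    ext x'
    simp [FinPath.mem_Z_iff hx]
  rw [h]
  refine (InfPath.isCompact_setOf_src_eq hA x.src).inter_right (isClosed_biInter fun i _ => ?_)
  have : Continuous fun x' : InfPath A => x'.1 i := (continuous_apply i).comp continuous_subtype_val
  exact (isClosed_discrete {x.1 i}).preimage this

theorem InfPath.exists_src_eq (hout : ∀ v, ∃ e : Edge A, e.src = v) (v : V) :
    ∃ x : InfPath A, x.src = v := by
  choose next hnext using hout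
  exact ⟨⟨fun n => (fun e => next e.tgt)^[n] (next v), fun i => by
    simp only [Function.iterate_succ_apply', hnext]⟩, hnext v⟩

theorem FinPath.nonempty_Z (hout : ∀ v, ∃ e : Edge A, e.src = v) (α : FinPath A) :
    α.Z.Nonempty := by
  obtain ⟨y, hy⟩ := InfPath.exists_src_eq hout α.tgt
  exact ⟨_, α.concat_mem y hy⟩

theorem FinPath.exists_length_eq_mem_Z (n : ℕ) (x : InfPath A) :
    ∃ β : FinPath A, β.length = n ∧ x ∈ β.Z := by
  induction n with
  | zero => exact ⟨vertex A x.src, rfl, x, rfl, rfl⟩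
  | succ n ih =>
    obtain ⟨β, hβ, hx⟩ := ih
    exact ⟨_, by rw [length_snoc, hβ], snoc_mem hx⟩

theorem FinPath.Z_subset_of_length_le {α β : FinPath A} {x : InfPath A} (hα : x ∈ α.Z)
    (hβ : x ∈ β.Z) (h : α.length ≤ β.length) : β.Z ⊆ α.Z := fun _ hy =>
  have ⟨hsrc, hi⟩ := (mem_Z_iff hβ).1 hy
  (mem_Z_iff hα).2 ⟨hsrc, fun i hi' => hi i (hi'.trans_le h)⟩

variable (A) in
/-- The finite paths of length `n`. -/
abbrev LevelPath (n : ℕ) : Type _ := {α : FinPath A // α.length = n}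

theorem isLevelBasis_Z (hA : RowFinite A) (hout : ∀ v, ∃ e : Edge A, e.src = v) :
    IsLevelBasis fun n (α : LevelPath A n) => α.1.Z where
  isOpen _ α := α.1.isOpen_Z
  isCompact _ α := α.1.isCompact_Z hA
  nonempty _ α := α.1.nonempty_Z hout
  eq_of_mem {_ α β _} hα hβ := Subtype.ext (FinPath.eq_of_mem hα hβ (α.2.trans β.2.symm))
  exists_subset {n k α x} hnk hα := by
    obtain ⟨β, hβ, hx⟩ := FinPath.exists_length_eq_mem_Z k x
    exact ⟨⟨β, hβ⟩, hx, FinPath.Z_subset_of_length_le hα hx (by rwa [α.2, hβ])⟩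
  exists_mem {W x} hW hx := by
    obtain ⟨n, hn⟩ := InfPath.exists_cylinder hW hx
    obtain ⟨β, rfl, hxβ⟩ := FinPath.exists_length_eq_mem_Z n x
    exact ⟨_, ⟨β, rfl⟩, hxβ, fun y hy => hn y ((FinPath.mem_Z_iff hxβ).1 hy).2⟩

end Paths

section Arrows

theorem PseudoFree.eq_of_act_eq (hpf : PseudoFree A B) {m m' : ℤ} {e : Edge A}
    (hact : e.act B m = e.act B m') (hcocycle : e.cocycle B m = e.cocycle B m') : m = m' := by
  have h₁ := Edge.act_add B (m - m') m' e
  have h₂ := Edge.cocycle_add B (m - m') m' e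
  rw [sub_add_cancel] at h₁ h₂
  exact sub_eq_zero.1 (hpf (m - m') (e.act B m') (by rw [← h₁, hact]) (by linarith))

theorem Quad.next_injective (hpf : PseudoFree A B) :
    Function.Injective (Quad.next B : Quad A → Quad A) := by
  intro q q' h
  have hx : q.x = q'.x := by rw [← Quad.next_x B q, h, Quad.next_x]
  have hr : q.rng B = q'.rng B := by rw [← Quad.rng_next, h, Quad.rng_next]
  have hα : q.t.α.length = q'.t.α.length := by
    simpa using congrArg (fun q : Quad A => q.t.α.length) h
  have hβ : q.t.β.length = q'.t.β.length := by
    simpa using congrArg (fun q : Quad A => q.t.β.length) h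
  have hφ : (q.x.1 q.t.β.length).cocycle B q.t.m = (q'.x.1 q'.t.β.length).cocycle B q'.t.m :=
    congrArg (fun q : Quad A => q.t.m) h
  refine Quad.ext' B hx hr hα hβ (hpf.eq_of_act_eq (e := q.x.1 q.t.β.length) ?_ ?_)
  · rw [← Quad.rng_apply, hr, hα, Quad.rng_apply, hx, hβ]
  · rw [hφ, hx, hβ]

theorem Quad.eq_of_mk_eq (hpf : PseudoFree A B) {q q' : Quad A} (h : q.mk' B = q'.mk' B)
    (hβ : q.t.β.length = q'.t.β.length) : q = q' := by
  obtain ⟨n, n', e⟩ := (Quad.mk_eq_iff B).1 h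
  have hlen := congrArg (fun q : Quad A => q.t.β.length) e
  simp only [Quad.iterate_β_length] at hlen
  obtain rfl : n = n' := by omega
  exact (Quad.next_injective hpf).iterate n e

variable (A B) in
/-- The space of arrows of `ℋ_{A,B}`. -/
abbrev KerArrow : Type _ := {g : Arrow A B // Arrow.ρ g = 0}

variable (A) in
/-- The triples `(α, m, β)` with `|α| = |β| = n`. -/
abbrev LevelTriple (n : ℕ) : Type _ := {t : Triple A // t.α.length = n ∧ t.β.length = n}

namespace LevelTriple

variable {n : ℕ}

variable (B) in
/-- The set `Z(α, m, β; Z(β))`, as a subset of `ℋ_{A,B}`. -/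
def set (t : LevelTriple A n) : Set (KerArrow A B) := {g | g.1 ∈ Arrow.basicSet B t.1}

/-- The triple `(β, -m, α)`, which represents the inverses of the arrows in `Z(α, m, β; Z(β))`. -/
def inv (t : LevelTriple A n) : LevelTriple A n :=
  ⟨⟨t.1.β, -t.1.m, t.1.α, t.1.tgt_eq.symm⟩, t.2.symm⟩

theorem inv_inv (t : LevelTriple A n) : t.inv.inv = t :=
  Subtype.ext (Triple.ext rfl (neg_neg _) rfl)

theorem bijOn_s (t : LevelTriple A n) :
    Set.BijOn (kerGroupoid A B).s (t.set B) t.1.β.Z := by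
  refine ⟨?_, ?_, fun x hx => ?_⟩
  · rintro g ⟨x, hx, hg⟩
    change g.1.s ∈ _
    rw [hg]
    exact hx
  · rintro g ⟨x, hx, hg⟩ g' ⟨x', hx', hg'⟩ (h : g.1.s = g'.1.s)
    rw [hg, hg'] at h
    obtain rfl : x = x' := h
    exact Subtype.ext (hg.trans hg'.symm)
  · refine ⟨⟨(Quad.mk t.1 x hx).mk' B, ?_⟩, ⟨x, hx, rfl⟩, rfl⟩
    exact sub_eq_zero.2 (congrArg _ (t.2.1.trans t.2.2.symm))

theorem bijOn_inv (t : LevelTriple A n) :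
    Set.BijOn (kerGroupoid A B).inv (t.set B) (t.inv.set B) := by
  have hmaps (t : LevelTriple A n) : Set.MapsTo (kerGroupoid A B).inv (t.set B) (t.inv.set B) := by
    rintro ⟨g, _⟩ ⟨x, hx, rfl⟩
    exact Arrow.mk_mem_basicSet ((Quad.mk t.1 x hx).inv B)
  refine Set.InvOn.bijOn (f' := (kerGroupoid A B).inv)
    ⟨fun g _ => (kerGroupoid A B).inv_inv g, fun g _ => (kerGroupoid A B).inv_inv g⟩ (hmaps t) ?_
  simpa only [inv_inv] using hmaps t.inv

theorem bijOn_r (t : LevelTriple A n) :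
    Set.BijOn (kerGroupoid A B).r (t.set B) t.1.α.Z :=
  (t.inv.bijOn_s.comp t.bijOn_inv).congr fun g _ => (kerGroupoid A B).s_inv g

theorem eq_of_mem (hpf : PseudoFree A B) {t t' : LevelTriple A n} {g : KerArrow A B}
    (h : g ∈ t.set B) (h' : g ∈ t'.set B) : t = t' := by
  obtain ⟨x, hx, e⟩ := h
  obtain ⟨x', hx', e'⟩ := h'
  have := Quad.eq_of_mk_eq hpf (e.symm.trans e') (t.2.2.trans t'.2.2.symm)
  exact Subtype.ext (congrArg Quad.t this)

theorem isOpen_set (t : LevelTriple A n) : IsOpen (t.set B) :=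
  (Arrow.isOpen_basicSet t.1).preimage continuous_subtype_val

theorem isCompact_set (hA : RowFinite A) (t : LevelTriple A n) : IsCompact (t.set B) :=
  isCompact_of_isLocalHomeomorph_of_injOn (kerGroupoid A B).isLocalHomeomorph_s t.isOpen_set
    t.bijOn_s.injOn (t.bijOn_s.image_eq ▸ t.1.β.isCompact_Z hA)

theorem nonempty_set (hout : ∀ v, ∃ e : Edge A, e.src = v) (t : LevelTriple A n) :
    (t.set B).Nonempty :=
  Set.image_nonempty.1 (t.bijOn_s.image_eq ▸ t.1.β.nonempty_Z hout)

theorem exists_set_subset {k : ℕ} {t : LevelTriple A n} {g : KerArrow A B} (hnk : n ≤ k)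
    (hg : g ∈ t.set B) : ∃ t' : LevelTriple A k, g ∈ t'.set B ∧ t'.set B ⊆ t.set B := by
  obtain ⟨x, hx, e⟩ := hg
  let q : Quad A := ⟨t.1, x, hx⟩
  refine ⟨⟨((Quad.next B)^[k - n] q).t, ?_, ?_⟩, ?_, ?_⟩
  · rw [Quad.iterate_α_length, t.2.1]; omega
  · rw [Quad.iterate_β_length, t.2.2]; omega
  · change g.1 ∈ Arrow.basicSet B ((Quad.next B)^[k - n] q).t
    rw [e, ← Quad.mk_iterate B (k - n)]
    exact Arrow.mk_mem_basicSet _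
  · exact fun g hg => Arrow.basicSet_anti q (Nat.zero_le (k - n)) hg

theorem exists_mem_set_subset {W : Set (KerArrow A B)} (hW : IsOpen W) {g : KerArrow A B}
    (hg : g ∈ W) : ∃ n, ∃ t : LevelTriple A n, g ∈ t.set B ∧ t.set B ⊆ W := by
  obtain ⟨S, hS, rfl⟩ := hW
  obtain ⟨g, hρ⟩ := g
  obtain ⟨q, rfl⟩ := Quot.exists_rep g
  obtain ⟨n, hn⟩ := Arrow.exists_basicSet hS q hg
  have hlen : q.t.α.length = q.t.β.length := Nat.cast_injective (sub_eq_zero.1 hρ)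
  refine ⟨q.t.β.length + n, ⟨((Quad.next B)^[n] q).t, ?_, ?_⟩, ?_, fun g hg => hn hg⟩
  · rw [Quad.iterate_α_length, hlen]
  · rw [Quad.iterate_β_length]
  · change q.mk' B ∈ Arrow.basicSet B ((Quad.next B)^[n] q).t
    rw [← Quad.mk_iterate B n]
    exact Arrow.mk_mem_basicSet _

end LevelTriple

theorem isLevelBasis_set (hA : RowFinite A) (hout : ∀ v, ∃ e : Edge A, e.src = v)
    (hpf : PseudoFree A B) : IsLevelBasis fun n (t : LevelTriple A n) => t.set B where
  isOpen _ t := t.isOpen_set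
  isCompact _ t := t.isCompact_set hA
  nonempty _ t := t.nonempty_set hout
  eq_of_mem := LevelTriple.eq_of_mem hpf
  exists_subset := LevelTriple.exists_set_subset
  exists_mem hW hg := LevelTriple.exists_mem_set_subset hW hg

end Arrows

section ComposablePairs

variable {n : ℕ}

variable (A) in
/-- The pairs of triples `(α, m, β)`, `(β, m', γ)` with `|α| = |β| = |γ| = n`. -/
abbrev LevelPair (n : ℕ) : Type _ := {p : LevelTriple A n × LevelTriple A n // p.1.1.β = p.2.1.α}

/-- The triple `(α, m + m', γ)`, which represents the products of the arrows in the members of the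
pair `(α, m, β)`, `(β, m', γ)`. -/
def LevelPair.comp (p : LevelPair A n) : LevelTriple A n :=
  ⟨⟨p.1.1.1.α, p.1.1.1.m + p.1.2.1.m, p.1.2.1.β,
    p.1.1.1.tgt_eq.trans (p.2 ▸ p.1.2.1.tgt_eq)⟩, p.1.1.2.1, p.1.2.2.2⟩

theorem beta_eq_alpha_iff_nonempty_pairsIn (hout : ∀ v, ∃ e : Edge A, e.src = v)
    (t t' : LevelTriple A n) :
    t.1.β = t'.1.α ↔ ((kerGroupoid A B).pairsIn (t.set B) (t'.set B)).Nonempty := by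
  constructor
  · intro h
    obtain ⟨g', hg'⟩ := t'.nonempty_set (B := B) hout
    obtain ⟨g, hg, e⟩ := t.bijOn_s.surjOn (h ▸ t'.bijOn_r.mapsTo hg')
    exact ⟨⟨(g, g'), e⟩, hg, hg'⟩
  · rintro ⟨p, hp, hp'⟩
    exact FinPath.eq_of_mem (t.bijOn_s.mapsTo hp) (p.2 ▸ t'.bijOn_r.mapsTo hp')
      (t.2.2.trans t'.2.1.symm)

theorem isLevelBasis_pairsIn (hA : RowFinite A) (hout : ∀ v, ∃ e : Edge A, e.src = v)
    (hpf : PseudoFree A B) : IsLevelBasis fun n (p : LevelPair A n) =>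
      (kerGroupoid A B).pairsIn (p.1.1.set B) (p.1.2.set B) :=
  (isLevelBasis_set hA hout hpf).pairs _ fun _ p =>
    beta_eq_alpha_iff_nonempty_pairsIn hout p.1 p.2

theorem LevelPair.image_d₁_pairsIn (p : LevelPair A n) :
    (kerGroupoid A B).d₁ '' (kerGroupoid A B).pairsIn (p.1.1.set B) (p.1.2.set B) =
      p.comp.set B := by
  have hmul {g : (kerGroupoid A B).Pairs} {x y : InfPath A} (hx : x ∈ p.1.2.1.β.Z)
      (hy : y ∈ p.1.1.1.β.Z) (h₁ : g.1.1.1 = (Quad.mk p.1.1.1 y hy).mk' B)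
      (h₂ : g.1.2.1 = (Quad.mk p.1.2.1 x hx).mk' B) :
      ((kerGroupoid A B).d₁ g).1 = (Quad.mk p.comp.1 x hx).mk' B := by
    obtain ⟨⟨⟨g, _⟩, ⟨g', _⟩⟩, c⟩ := g
    dsimp only at h₁ h₂
    subst h₁ h₂
    exact Arrow.mul_mk (B := B) ⟨p.1.1.1, y, hy⟩ ⟨p.1.2.1, x, hx⟩ p.2 c
  apply Set.Subset.antisymm
  · rintro _ ⟨g, ⟨⟨y, hy, h₁⟩, ⟨x, hx, h₂⟩⟩, rfl⟩
    exact ⟨x, hx, hmul hx hy h₁ h₂⟩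
  · rintro k ⟨x, hx, hk⟩
    obtain ⟨g', hg', hs⟩ := (p.1.2.bijOn_s (B := B)).surjOn hx
    obtain ⟨g, hg, e⟩ := (p.1.1.bijOn_s (B := B)).surjOn (p.2 ▸ p.1.2.bijOn_r.mapsTo hg')
    refine ⟨⟨(g, g'), e⟩, ⟨hg, hg'⟩, Subtype.ext ?_⟩
    obtain ⟨y, hy, h₁⟩ := hg
    obtain ⟨x', hx', h₂⟩ := hg'
    obtain rfl : x' = x := by
      rw [← hs]
      change x' = g'.1.s
      rw [h₂]
      rfl
    rw [hmul hx' hy h₁ h₂, hk]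

end ComposablePairs

section LevelComplex

variable {n : ℕ}

namespace LevelTriple

/-- The path `α` of a triple `(α, m, β)`. -/
def rng (t : LevelTriple A n) : LevelPath A n := ⟨t.1.α, t.2.1⟩

/-- The path `β` of a triple `(α, m, β)`. -/
def src (t : LevelTriple A n) : LevelPath A n := ⟨t.1.β, t.2.2⟩

end LevelTriple

variable (A n)

/-- The differential `δ₂` on linear combinations of indicator functions of level `n`. -/
noncomputable def levelBoundary₂ : (LevelPair A n →₀ ℤ) →ₗ[ℤ] LevelTriple A n →₀ ℤ :=
  Finsupp.linearCombination ℤ fun p =>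
    Finsupp.single p.1.2 1 - Finsupp.single p.comp 1 + Finsupp.single p.1.1 1

/-- The differential `δ₁` on linear combinations of indicator functions of level `n`. -/
noncomputable def levelBoundary₁ : (LevelTriple A n →₀ ℤ) →ₗ[ℤ] LevelPath A n →₀ ℤ :=
  Finsupp.linearCombination ℤ fun t => Finsupp.single t.src 1 - Finsupp.single t.rng 1

/-- The map `(α, m, β) ↦ m 1_{r(β)}`, whose kernel on the cycles of level `n` is the
group of boundaries. -/
noncomputable def isotropySum : (LevelTriple A n →₀ ℤ) →ₗ[ℤ] V →₀ ℤ :=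
  Finsupp.linearCombination ℤ fun t => Finsupp.single t.1.β.tgt t.1.m

variable {A n}

theorem isotropySum_single_one (t : LevelTriple A n) :
    isotropySum A n (Finsupp.single t 1) = Finsupp.single t.1.β.tgt t.1.m := by
  rw [isotropySum, Finsupp.linearCombination_single, one_smul]

theorem isotropySum_levelBoundary₂ (x : LevelPair A n →₀ ℤ) :
    isotropySum A n (levelBoundary₂ A n x) = 0 := by
  suffices isotropySum A n ∘ₗ levelBoundary₂ A n = 0 from LinearMap.congr_fun this x
  refine Finsupp.lhom_ext' fun p => LinearMap.ext_ring ?_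
  have htgt : p.1.1.1.β.tgt = p.1.2.1.β.tgt := by rw [p.2, p.1.2.1.tgt_eq]
  simp only [LinearMap.comp_apply, Finsupp.lsingle_apply, levelBoundary₂,
    Finsupp.linearCombination_single, one_smul, map_add, map_sub, isotropySum_single_one,
    LinearMap.zero_apply]
  rw [htgt, LevelPair.comp, Finsupp.single_add]
  abel

theorem δ₁_realize (hZ : IsLevelBasis fun n (α : LevelPath A n) => α.1.Z)
    (hS : IsLevelBasis fun n (t : LevelTriple A n) => t.set B) (x : LevelTriple A n →₀ ℤ) :
    (kerGroupoid A B).δ₁ (hS.realize ℤ n x) = hZ.realize ℤ n (levelBoundary₁ A n x) := by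
  induction x using Finsupp.induction_linear with
  | zero => simp
  | add x y hx hy => simp only [map_add, hx, hy, CompactlySupportedContinuousMap.coe_add]
  | single t c =>
    have h := (kerGroupoid A B).δ₁_eq_sub_indicator
      (coe_clopenIndicator (hS.isClopen n t) (hS.isCompact n t)) t.bijOn_s t.bijOn_r
    rw [← Finsupp.smul_single_one, map_smul, hS.realize_single_one, map_zsmul, h, levelBoundary₁]
    simp only [map_smul, Finsupp.linearCombination_single, one_smul, map_sub,
      hZ.realize_single_one]
    rfl

theorem δ₂_realize (hP : IsLevelBasis fun n (p : LevelPair A n) =>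
      (kerGroupoid A B).pairsIn (p.1.1.set B) (p.1.2.set B))
    (hS : IsLevelBasis fun n (t : LevelTriple A n) => t.set B) (x : LevelPair A n →₀ ℤ) :
    (kerGroupoid A B).δ₂ (hP.realize ℤ n x) = hS.realize ℤ n (levelBoundary₂ A n x) := by
  induction x using Finsupp.induction_linear with
  | zero => simp
  | add x y hx hy => simp only [map_add, hx, hy, CompactlySupportedContinuousMap.coe_add]
  | single p c =>
    have h := (kerGroupoid A B).δ₂_eq_indicator
      (coe_clopenIndicator (hP.isClopen n p) (hP.isCompact n p)) p.1.1.bijOn_s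
      (p.2 ▸ p.1.2.bijOn_r) p.1.1.bijOn_r.injOn p.1.2.bijOn_s.injOn
    rw [← Finsupp.smul_single_one, map_smul, hP.realize_single_one, map_zsmul, h,
      p.image_d₁_pairsIn, levelBoundary₂]
    simp only [map_smul, Finsupp.linearCombination_single, one_smul, map_sub, map_add,
      hS.realize_single_one]
    rfl

/-- The triple `(α, m, β)` of paths of length `n`. -/
def LevelTriple.of (α : LevelPath A n) (m : ℤ) (β : LevelPath A n) (h : α.1.tgt = β.1.tgt) :
    LevelTriple A n :=
  ⟨⟨α.1, m, β.1, h⟩, α.2, β.2⟩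

section Cocycle

variable {P : Type*} [AddCommGroup P] {c : LevelTriple A n → P}
  (hc : ∀ p : LevelPair A n, c p.comp = c p.1.1 + c p.1.2)

include hc

theorem cocycle_of_add {α β γ : LevelPath A n} (h : α.1.tgt = β.1.tgt) (h' : β.1.tgt = γ.1.tgt)
    (m m' : ℤ) : c (.of α (m + m') γ (h.trans h')) = c (.of α m β h) + c (.of β m' γ h') :=
  hc ⟨(.of α m β h, .of β m' γ h'), rfl⟩

theorem cocycle_of_self (α : LevelPath A n) (m : ℤ) :
    c (.of α m α rfl) = m • c (.of α 1 α rfl) := by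
  let f : ℤ →+ P := AddMonoidHom.mk' (fun m => c (.of α m α rfl)) (cocycle_of_add hc rfl rfl)
  have h : f (m • 1) = m • f 1 := map_zsmul f m 1
  rwa [smul_eq_mul, mul_one] at h

theorem cocycle_of_one_eq {α β : LevelPath A n} (h : α.1.tgt = β.1.tgt) :
    c (.of α 1 α rfl) = c (.of β 1 β rfl) := by
  have h₁ := cocycle_of_add hc rfl h 1 0
  have h₂ := cocycle_of_add hc h rfl 0 1
  rw [add_comm 0 1, h₁, add_comm] at h₂
  exact add_left_cancel h₂

theorem exists_linearCombination_cocycle_eq :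
    ∃ (u : (LevelPath A n →₀ ℤ) →ₗ[ℤ] P) (v : (V →₀ ℤ) →ₗ[ℤ] P),
      Finsupp.linearCombination ℤ c = u ∘ₗ levelBoundary₁ A n + v ∘ₗ isotropySum A n := by
  let tgt (α : LevelPath A n) : V := α.1.tgt
  -- Comparing with a base path `τ` for each vertex writes `c (α, m, β)` as
  -- `c (α, 0, τ) - c (β, 0, τ) + m • c (β, 1, β)`.
  let τ (α : LevelPath A n) : LevelPath A n := Set.rangeSplitting tgt ⟨tgt α, α, rfl⟩
  have hτ (α : LevelPath A n) : α.1.tgt = (τ α).1.tgt :=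
    (Set.apply_rangeSplitting tgt ⟨tgt α, α, rfl⟩).symm
  have hfac : Function.FactorsThrough (fun α => c (.of α 1 α rfl)) tgt := fun _ _ h =>
    cocycle_of_one_eq hc h
  refine ⟨Finsupp.linearCombination ℤ fun α => -c (.of α 0 (τ α) (hτ α)),
    Finsupp.linearCombination ℤ (Function.extend tgt (fun α => c (.of α 1 α rfl)) 0),
    Finsupp.lhom_ext' fun t => LinearMap.ext_ring ?_⟩
  have htgt : t.rng.1.tgt = t.src.1.tgt := t.1.tgt_eq
  have hτt : τ t.rng = τ t.src := congrArg (Set.rangeSplitting tgt) (Subtype.ext htgt)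
  have hsplit : c t = c (.of t.rng 0 t.src htgt) + t.1.m • c (.of t.src 1 t.src rfl) := by
    have h := cocycle_of_add hc htgt rfl 0 t.1.m
    rwa [zero_add, cocycle_of_self hc t.src t.1.m] at h
  have hbase : c (.of t.rng 0 (τ t.rng) (hτ t.rng)) =
      c (.of t.rng 0 t.src htgt) + c (.of t.src 0 (τ t.src) (hτ t.src)) := by
    simpa only [hτt, add_zero] using cocycle_of_add hc htgt (hτ t.src) 0 0
  have hext := hfac.extend_apply 0 t.src
  simp only [LinearMap.comp_apply, LinearMap.add_apply, Finsupp.lsingle_apply, levelBoundary₁,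
    isotropySum, Finsupp.linearCombination_single, one_smul, map_sub]
  rw [show t.1.β.tgt = tgt t.src from rfl, hext, hsplit, hbase]
  abel

end Cocycle

theorem mem_range_levelBoundary₂ {x : LevelTriple A n →₀ ℤ} (h₁ : levelBoundary₁ A n x = 0)
    (h : isotropySum A n x = 0) : x ∈ LinearMap.range (levelBoundary₂ A n) := by
  let c (t : LevelTriple A n) := (LinearMap.range (levelBoundary₂ A n)).mkQ (.single t 1)
  have hc (p : LevelPair A n) : c p.comp = c p.1.1 + c p.1.2 := by
    rw [← sub_eq_zero, ← map_add, ← map_sub, Submodule.mkQ_apply, Submodule.Quotient.mk_eq_zero]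
    refine ⟨-.single p 1, ?_⟩
    rw [map_neg, levelBoundary₂, Finsupp.linearCombination_single, one_smul]
    abel
  obtain ⟨u, v, huv⟩ := exists_linearCombination_cocycle_eq hc
  have hmkQ : (LinearMap.range (levelBoundary₂ A n)).mkQ = Finsupp.linearCombination ℤ c :=
    Finsupp.lhom_ext' fun t => LinearMap.ext_ring (by simp [c])
  rw [← Submodule.ker_mkQ (LinearMap.range _), LinearMap.mem_ker, hmkQ, huv, LinearMap.add_apply,
    LinearMap.comp_apply, LinearMap.comp_apply, h₁, h, map_zero, map_zero, add_zero]

end LevelComplex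

section Subdivision

/-- The finite set of edges with source `v`. -/
noncomputable def outEdges (hA : RowFinite A) (v : V) : Finset (Edge A) :=
  (finite_setOf_src_eq hA v).toFinset

@[simp] theorem mem_outEdges {hA : RowFinite A} {v : V} {e : Edge A} :
    e ∈ outEdges hA v ↔ e.src = v := (finite_setOf_src_eq hA v).mem_toFinset

theorem sum_single_cocycle_outEdges (hA : RowFinite A) (hB : RowFinite B)
    (hA₀ : ∀ i j, 0 ≤ A i j) (hAB : ∀ i j, A i j = 0 → B i j = 0) (v : V) (m : ℤ) :
    ∑ e ∈ outEdges hA v, Finsupp.single e.tgt (e.cocycle B m) =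
      connecting B hB (Finsupp.single v m) := by
  classical
  ext w
  have hfilter : (outEdges hA v).filter (fun e => e.tgt = w) = edgesBetween A v w := by
    ext e
    simp
  rw [Finsupp.finsetSum_apply, connecting, Finsupp.linearCombination_single, Finsupp.smul_apply,
    Finsupp.ofSupportFinite_coe, smul_eq_mul, ← sum_cocycle_edgesBetween (hA₀ v w) (hAB v w) m,
    ← hfilter, Finset.sum_filter]
  simp only [Finsupp.single_apply]

variable {n : ℕ}

namespace LevelTriple

variable (B) in
/-- The triple `(α κ_m(γ), φ(m, γ), β γ)`. -/
def snoc (t : LevelTriple A n) (γ : Edge A) (h : γ.src = t.1.β.tgt) : LevelTriple A (n + 1) :=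
  ⟨t.1.snoc B γ h,
    (FinPath.length_snoc t.1.α (γ.act B t.1.m) (h.trans t.1.tgt_eq.symm)).trans
      (congrArg Nat.succ t.2.1),
    (FinPath.length_snoc t.1.β γ h).trans (congrArg Nat.succ t.2.2)⟩

theorem mem_set_snoc {t : LevelTriple A n} {γ : Edge A} (h : γ.src = t.1.β.tgt)
    {g : KerArrow A B} : g ∈ (t.snoc B γ h).set B ↔ g ∈ t.set B ∧ g.1.s.1 n = γ := by
  have hstep {x : InfPath A} (hx : x ∈ t.1.β.Z) (hx' : x ∈ (t.1.snoc B γ h).β.Z) :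
      (Quad.mk t.1 x hx).mk' B = (Quad.mk (t.1.snoc B γ h) x hx').mk' B :=
    Quot.sound ⟨rfl, γ, h, rfl⟩
  constructor
  · rintro ⟨x, hx, e⟩
    obtain ⟨hxβ, hxγ⟩ := FinPath.mem_of_snoc_mem h hx
    rw [t.2.2] at hxγ
    exact ⟨⟨x, hxβ, e.trans (hstep hxβ hx).symm⟩, e ▸ hxγ⟩
  · rintro ⟨⟨x, hx, e⟩, hγ⟩
    obtain rfl : x.1 t.1.β.length = γ := by
      rw [t.2.2, ← hγ, e]
      rfl
    exact ⟨x, FinPath.snoc_mem hx, e.trans (hstep hx _)⟩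

variable (B) in
/-- The triples `(α κ_m(γ), φ(m, γ), β γ)`, where `γ` ranges over the edges with source `r(β)`. -/
noncomputable def children (hA : RowFinite A) (t : LevelTriple A n) :
    Finset (LevelTriple A (n + 1)) :=
  (outEdges hA t.1.β.tgt).attach.map
    ⟨fun γ => t.snoc B γ.1 (mem_outEdges.1 γ.2), fun γ γ' h => Subtype.ext <| by
      simpa [snoc, Triple.snoc, FinPath.snoc] using congrArg (fun t => t.1.β.edges) h⟩

theorem mem_children {hA : RowFinite A} {t : LevelTriple A n} {t' : LevelTriple A (n + 1)} :
    t' ∈ t.children B hA ↔ ∃ γ h, t.snoc B γ h = t' := by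
  constructor
  · intro ht'
    obtain ⟨γ, -, h⟩ := Finset.mem_map.1 ht'
    exact ⟨γ.1, mem_outEdges.1 γ.2, h⟩
  · rintro ⟨γ, h, rfl⟩
    exact Finset.mem_map.2 ⟨⟨γ, mem_outEdges.2 h⟩, Finset.mem_attach _ _, rfl⟩

theorem mem_set_iff_exists_mem_children (hA : RowFinite A) (t : LevelTriple A n)
    (g : KerArrow A B) : g ∈ t.set B ↔ ∃ t' ∈ t.children B hA, g ∈ t'.set B := by
  constructor
  · intro hg
    have hsrc := FinPath.src_apply_of_mem (t.bijOn_s.mapsTo hg)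
    rw [t.2.2] at hsrc
    exact ⟨_, mem_children.2 ⟨_, hsrc, rfl⟩, (mem_set_snoc hsrc).2 ⟨hg, rfl⟩⟩
  · rintro ⟨t', ht', hg⟩
    obtain ⟨γ, h, rfl⟩ := mem_children.1 ht'
    exact ((mem_set_snoc h).1 hg).1

end LevelTriple

variable (B n) in
/-- The expression of the indicator functions of level `n` by those of level `n + 1`. -/
noncomputable def subdivide (hA : RowFinite A) :
    (LevelTriple A n →₀ ℤ) →ₗ[ℤ] LevelTriple A (n + 1) →₀ ℤ :=
  Finsupp.linearCombination ℤ fun t => ∑ t' ∈ t.children B hA, Finsupp.single t' 1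

theorem realize_subdivide (hS : IsLevelBasis fun n (t : LevelTriple A n) => t.set B)
    (hA : RowFinite A) (x : LevelTriple A n →₀ ℤ) :
    hS.realize ℤ (n + 1) (subdivide B n hA x) = hS.realize ℤ n x := by
  suffices hS.realize ℤ (n + 1) ∘ₗ subdivide B n hA = hS.realize ℤ n from LinearMap.congr_fun this x
  refine Finsupp.lhom_ext' fun t => LinearMap.ext_ring ?_
  simp only [LinearMap.comp_apply, Finsupp.lsingle_apply, subdivide,
    Finsupp.linearCombination_single, one_smul]
  exact hS.realize_sum_single_one fun g => t.mem_set_iff_exists_mem_children hA g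

theorem isotropySum_subdivide (hA : RowFinite A) (hB : RowFinite B) (hA₀ : ∀ i j, 0 ≤ A i j)
    (hAB : ∀ i j, A i j = 0 → B i j = 0) (x : LevelTriple A n →₀ ℤ) :
    isotropySum A (n + 1) (subdivide B n hA x) = connecting B hB (isotropySum A n x) := by
  suffices isotropySum A (n + 1) ∘ₗ subdivide B n hA = connecting B hB ∘ₗ isotropySum A n from
    LinearMap.congr_fun this x
  refine Finsupp.lhom_ext' fun t => LinearMap.ext_ring ?_
  simp only [LinearMap.comp_apply, Finsupp.lsingle_apply, subdivide, LevelTriple.children,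
    Finsupp.linearCombination_single, one_smul, Finset.sum_map, map_sum, isotropySum_single_one,
    ← sum_single_cocycle_outEdges hA hB hA₀ hAB]
  exact Finset.sum_attach (outEdges hA t.1.β.tgt)
    fun e => Finsupp.single e.tgt (e.cocycle B t.1.m)

theorem exists_realize_eq_of_le (hS : IsLevelBasis fun n (t : LevelTriple A n) => t.set B)
    (hA : RowFinite A) (hB : RowFinite B) (hA₀ : ∀ i j, 0 ≤ A i j)
    (hAB : ∀ i j, A i j = 0 → B i j = 0) {k : ℕ} (hnk : n ≤ k) (x : LevelTriple A n →₀ ℤ) :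
    ∃ y, hS.realize ℤ k y = hS.realize ℤ n x ∧
      isotropySum A k y = (connecting B hB ^ (k - n)) (isotropySum A n x) := by
  induction k, hnk using Nat.le_induction with
  | base => exact ⟨x, rfl, by simp⟩
  | succ k hk ih =>
    obtain ⟨y, hy, hsum⟩ := ih
    refine ⟨subdivide B k hA y, (realize_subdivide hS hA y).trans hy, ?_⟩
    rw [isotropySum_subdivide hA hB hA₀ hAB, hsum, Nat.succ_sub hk, pow_succ',
      Module.End.mul_apply]

end Subdivision

section Limit

variable (hB : RowFinite B)

theorem toLimit_pow {n k : ℕ} (hnk : n ≤ k) (x : V →₀ ℤ) :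
    toLimit B hB k ((connecting B hB ^ (k - n)) x) = toLimit B hB n x :=
  Module.DirectLimit.of_f (f := fun i j (_ : i ≤ j) => connecting B hB ^ (j - i)) (hij := hnk)

theorem exists_pow_eq_zero {n : ℕ} {x : V →₀ ℤ} (h : toLimit B hB n x = 0) :
    ∃ k, n ≤ k ∧ (connecting B hB ^ (k - n)) x = 0 := by
  have : DirectedSystem (fun _ : ℕ => V →₀ ℤ)
      (fun i j (_ : i ≤ j) => ⇑(connecting B hB ^ (j - i))) :=
    { map_self := fun i x => by simp
      map_map := fun i j k hij hjk x => by
        rw [← Module.End.mul_apply, ← pow_add]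
        congr 2
        omega }
  obtain ⟨k, hk, e⟩ := Module.DirectLimit.of.zero_exact h
  exact ⟨k, hk, e⟩

theorem toLimit_isotropySum_eq (hS : IsLevelBasis fun n (t : LevelTriple A n) => t.set B)
    (hA : RowFinite A) (hA₀ : ∀ i j, 0 ≤ A i j) (hAB : ∀ i j, A i j = 0 → B i j = 0) {n k : ℕ}
    {x : LevelTriple A n →₀ ℤ} {y : LevelTriple A k →₀ ℤ}
    (h : hS.realize ℤ n x = hS.realize ℤ k y) :
    toLimit B hB n (isotropySum A n x) = toLimit B hB k (isotropySum A k y) := by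
  obtain ⟨x', hx', hxsum⟩ := exists_realize_eq_of_le hS hA hB hA₀ hAB (le_max_left n k) x
  obtain ⟨y', hy', hysum⟩ := exists_realize_eq_of_le hS hA hB hA₀ hAB (le_max_right n k) y
  obtain rfl : x' = y' := hS.realize_injective _ (by rw [hx', hy', h])
  rw [← toLimit_pow hB (le_max_left n k), ← toLimit_pow hB (le_max_right n k), ← hxsum, ← hysum]

end Limit

section Generators

variable {n : ℕ}

variable (A n) in
/-- The set of vertices that are ranges of paths of length `n`. -/
def ranges : Set V := {w | ∃ α : FinPath A, α.length = n ∧ α.tgt = w}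

theorem tgt_mem_ranges_succ {e : Edge A} (h : e.src ∈ ranges A n) : e.tgt ∈ ranges A (n + 1) := by
  obtain ⟨α, hα, hsrc⟩ := h
  exact ⟨α.snoc e hsrc.symm, by rw [FinPath.length_snoc, hα], rfl⟩

theorem ranges_antitone : Antitone (ranges A) := by
  refine antitone_nat_of_succ_le fun n w ⟨⟨v, w', l, hl⟩, hlen, htgt⟩ => ?_
  cases l with
  | nil => simp [FinPath.length] at hlen
  | cons e l => exact ⟨⟨e.tgt, w', l, hl.2⟩, by simpa [FinPath.length] using hlen, htgt⟩

theorem ranges_eq_univ (hin : ∀ w, ∃ e : Edge A, e.tgt = w) : ranges A n = Set.univ := by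
  refine Set.eq_univ_of_forall ?_
  induction n with
  | zero => exact fun w => ⟨FinPath.vertex A w, rfl, rfl⟩
  | succ n ih =>
    intro w
    obtain ⟨e, rfl⟩ := hin w
    exact tgt_mem_ranges_succ (ih e.src)

theorem exists_ranges_subset (h : Finite V ∨ ∀ w, ∃ e : Edge A, e.tgt = w) :
    ∃ K, ∀ n, K ≤ n → ranges A K ⊆ ranges A n := by
  rcases h with hV | hin
  · obtain ⟨K, hK⟩ := WellFoundedGT.monotone_chain_condition
      (⟨OrderDual.toDual ∘ ranges A, ranges_antitone⟩ : ℕ →o (Set V)ᵒᵈ)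
    exact ⟨K, fun n hn => (show ranges A K = ranges A n from hK n hn).subset⟩
  · exact ⟨0, fun n _ => by rw [ranges_eq_univ hin (n := n)]; exact Set.subset_univ _⟩

theorem exists_edge_of_ne_zero {v w : V} (hA₀ : 0 ≤ A v w) (h : A v w ≠ 0) :
    ∃ e : Edge A, e.src = v ∧ e.tgt = w :=
  ⟨⟨v, w, 0, le_rfl, hA₀.lt_of_ne' h⟩, rfl, rfl⟩

variable (hB : RowFinite B) (hA₀ : ∀ i j, 0 ≤ A i j) (hAB : ∀ i j, A i j = 0 → B i j = 0)

include hA₀ hAB in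
theorem support_connecting_pow_subset (x : V →₀ ℤ) :
    ↑((connecting B hB ^ n) x).support ⊆ ranges A n := by
  induction n with
  | zero => exact fun w _ => ⟨FinPath.vertex A w, rfl, rfl⟩
  | succ n ih =>
    intro w hw
    rw [pow_succ', Module.End.mul_apply, connecting, Finsupp.linearCombination_apply,
      Finset.mem_coe, Finsupp.mem_support_iff, Finsupp.sum_apply] at hw
    obtain ⟨v, hv, hvw⟩ := Finset.exists_ne_zero_of_sum_ne_zero hw
    have hBvw : B v w ≠ 0 := fun h => hvw (by simp [Finsupp.ofSupportFinite_coe, h])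
    obtain ⟨e, rfl, rfl⟩ := exists_edge_of_ne_zero (hA₀ v w) (mt (hAB v w) hBvw)
    exact tgt_mem_ranges_succ (ih hv)

include hA₀ hAB in
theorem closure_toLimit_eq_top (h : Finite V ∨ ∀ w, ∃ e : Edge A, e.tgt = w) :
    AddSubgroup.closure (Set.range fun α : FinPath A =>
      toLimit B hB α.length (Finsupp.single α.tgt 1)) = ⊤ := by
  refine (AddSubgroup.eq_top_iff' _).2 fun y => ?_
  obtain ⟨n, x, rfl⟩ := Module.DirectLimit.exists_of y
  obtain ⟨K, hK⟩ := exists_ranges_subset h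
  change toLimit B hB n x ∈ _
  rw [← toLimit_pow hB (Nat.le_add_right n K), Nat.add_sub_cancel_left]
  have hsupp := support_connecting_pow_subset hB hA₀ hAB (n := K) x
  generalize (connecting B hB ^ K) x = u at *
  rw [← Finsupp.sum_single u, Finsupp.sum, map_sum]
  refine AddSubgroup.sum_mem _ fun w hw => ?_
  obtain ⟨α, hα, rfl⟩ := hK (n + K) (Nat.le_add_left K n) (hsupp hw)
  rw [← hα, ← Finsupp.smul_single_one, map_smul]
  exact AddSubgroup.zsmul_mem _ (AddSubgroup.subset_closure (Set.mem_range_self α)) _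

end Generators

section Homology

variable (hB : RowFinite B) (hS : IsLevelBasis fun n (t : LevelTriple A n) => t.set B)
  (hA : RowFinite A) (hA₀ : ∀ i j, 0 ≤ A i j) (hAB : ∀ i j, A i j = 0 → B i j = 0)

/-- The homomorphism from compactly supported functions to `ℤ_B` that sends the indicator function
of `Z(α, m, β; Z(β))`, where `α` and `β` have length `n`, to `φ^B_{n,∞}(m 1_{r(β)})`. -/
noncomputable def limitHom : C_c(KerArrow A B, ℤ) →ₗ[ℤ] IndLimit B hB :=
  hS.lift (fun n => toLimit B hB n ∘ₗ isotropySum A n)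
    (toLimit_isotropySum_eq hB hS hA hA₀ hAB)

theorem limitHom_realize {n : ℕ} (x : LevelTriple A n →₀ ℤ) :
    limitHom hB hS hA hA₀ hAB (hS.realize ℤ n x) = toLimit B hB n (isotropySum A n x) :=
  hS.lift_realize _ n x

section

variable (hP : IsLevelBasis fun n (p : LevelPair A n) =>
  (kerGroupoid A B).pairsIn (p.1.1.set B) (p.1.2.set B))

include hP

theorem limitHom_eq_zero_of_mem_boundaries₁ {z : (kerGroupoid A B).cycles₁}
    (hz : z ∈ (kerGroupoid A B).boundaries₁) : limitHom hB hS hA hA₀ hAB z = 0 := by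
  obtain ⟨h, hh⟩ := hz
  obtain ⟨n, x, rfl⟩ := (hP.eventually_exists_realize h).exists
  rw [δ₂_realize hP hS] at hh
  rw [← DFunLike.coe_injective hh, limitHom_realize, isotropySum_levelBoundary₂, map_zero]

variable (hZ : IsLevelBasis fun n (α : LevelPath A n) => α.1.Z)

include hZ in
theorem mem_boundaries₁_of_limitHom_eq_zero {z : (kerGroupoid A B).cycles₁}
    (hz : limitHom hB hS hA hA₀ hAB z = 0) : z ∈ (kerGroupoid A B).boundaries₁ := by
  obtain ⟨n, x, hx⟩ := (hS.eventually_exists_realize z.1).exists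
  rw [← hx, limitHom_realize] at hz
  obtain ⟨k, hnk, hpow⟩ := exists_pow_eq_zero hB hz
  obtain ⟨y, hy, hsum⟩ := exists_realize_eq_of_le hS hA hB hA₀ hAB hnk x
  have hcycle : levelBoundary₁ A k y = 0 := by
    refine hZ.realize_injective k (DFunLike.coe_injective ?_)
    rw [← δ₁_realize hZ hS, hy, hx, map_zero]
    exact z.2
  obtain ⟨b, rfl⟩ := mem_range_levelBoundary₂ hcycle (hsum.trans hpow)
  exact ⟨hP.realize ℤ k b, by rw [δ₂_realize hP hS, hy, hx]⟩

/-- The homomorphism `H₁(ℋ_{A,B}) → ℤ_B` induced by `limitHom`. -/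
noncomputable def homologyHom : (kerGroupoid A B).H₁ →+ IndLimit B hB :=
  QuotientAddGroup.lift _
    ((limitHom hB hS hA hA₀ hAB).toAddMonoidHom.comp (kerGroupoid A B).cycles₁.subtype)
    fun _ => limitHom_eq_zero_of_mem_boundaries₁ hB hS hA hA₀ hAB hP

include hZ in
theorem homologyHom_injective : Function.Injective (homologyHom hB hS hA hA₀ hAB hP) := by
  refine (injective_iff_map_eq_zero _).2 fun c hc => ?_
  obtain ⟨z, rfl⟩ := QuotientAddGroup.mk_surjective c
  exact (QuotientAddGroup.eq_zero_iff z).2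
    (mem_boundaries₁_of_limitHom_eq_zero hB hS hA hA₀ hAB hP hZ hc)

end

/-- The cycle `1_{Z(α, 1, α; Z(α))}`. -/
noncomputable def diagCycle (α : FinPath A) : (kerGroupoid A B).cycles₁ :=
  let t : LevelTriple A α.length := ⟨⟨α, 1, α, rfl⟩, rfl, rfl⟩
  ⟨clopenIndicator ℤ (hS.isClopen _ t) (hS.isCompact _ t),
    ((kerGroupoid A B).δ₁_eq_sub_indicator (coe_clopenIndicator _ _) t.bijOn_s t.bijOn_r).trans
      (sub_self _)⟩

variable (hP : IsLevelBasis fun n (p : LevelPair A n) =>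
  (kerGroupoid A B).pairsIn (p.1.1.set B) (p.1.2.set B))

theorem homologyHom_diagCycle (α : FinPath A) :
    homologyHom hB hS hA hA₀ hAB hP ((kerGroupoid A B).homologyClass (diagCycle hS α)) =
      toLimit B hB α.length (Finsupp.single α.tgt 1) := by
  have h := limitHom_realize hB hS hA hA₀ hAB
    (Finsupp.single (⟨⟨α, 1, α, rfl⟩, rfl, rfl⟩ : LevelTriple A α.length) 1)
  rwa [hS.realize_single_one, isotropySum_single_one] at h

theorem homologyHom_surjective (h : Finite V ∨ ∀ w, ∃ e : Edge A, e.tgt = w) :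
    Function.Surjective (homologyHom hB hS hA hA₀ hAB hP) := by
  refine AddMonoidHom.range_eq_top.1 (top_unique ?_)
  rw [← closure_toLimit_eq_top hB hA₀ hAB h, AddSubgroup.closure_le]
  rintro _ ⟨α, rfl⟩
  exact ⟨_, homologyHom_diagCycle hB hS hA hA₀ hAB hP α⟩

end Homology

end Katsura

theorem mainTheorem3_general {V : Type*} (A B : Matrix V V ℤ)
    (hA : ∀ i j, 0 ≤ A i j)
    (hAfin : Katsura.RowFinite A) (hBfin : Katsura.RowFinite B)
    (hArow : ∀ i, ∃ j, A i j ≠ 0)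
    (hAB : ∀ i j, A i j = 0 → B i j = 0)
    (hpf : Katsura.PseudoFree A B)
    (hsrc : Finite V ∨ ∀ j, ∃ i, A i j ≠ 0) :
    ∃! Φ : (Katsura.kerGroupoid A B).H₁ ≃+ Katsura.IndLimit B hBfin,
      ∀ α : Katsura.FinPath A, ∃ z : (Katsura.kerGroupoid A B).cycles₁,
        ⇑(z : C_c({g : Katsura.Arrow A B // Katsura.Arrow.ρ g = 0}, ℤ)) =
          Set.indicator (Katsura.diagSet A B α 1) 1 ∧
        Φ ((Katsura.kerGroupoid A B).homologyClass z) =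
          Katsura.toLimit B hBfin α.length (Finsupp.single α.tgt 1) := by
  have hout v : ∃ e : Katsura.Edge A, e.src = v :=
    (hArow v).elim fun w h => (Katsura.exists_edge_of_ne_zero (hA v w) h).imp fun _ => And.left
  have hin : Finite V ∨ ∀ w, ∃ e : Katsura.Edge A, e.tgt = w := hsrc.imp_right fun h w =>
    (h w).elim fun v h => (Katsura.exists_edge_of_ne_zero (hA v w) h).imp fun _ => And.right
  have hZ := Katsura.isLevelBasis_Z hAfin hout
  have hS := Katsura.isLevelBasis_set hAfin hout hpf
  have hP := Katsura.isLevelBasis_pairsIn hAfin hout hpf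
  let Φ := AddEquiv.ofBijective (Katsura.homologyHom hBfin hS hAfin hA hAB hP)
    ⟨Katsura.homologyHom_injective hBfin hS hAfin hA hAB hP hZ,
      Katsura.homologyHom_surjective hBfin hS hAfin hA hAB hP hin⟩
  have hΦ := Katsura.homologyHom_diagCycle hBfin hS hAfin hA hAB hP
  refine ⟨Φ, fun α => ⟨Katsura.diagCycle hS α, rfl, hΦ α⟩, fun Ψ hΨ => ?_⟩
  suffices h : Ψ.symm.toAddMonoidHom = Φ.symm.toAddMonoidHom from
    AddEquiv.symm_bijective.injective (AddEquiv.toAddMonoidHom_injective h)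
  refine AddMonoidHom.eq_of_eqOn_dense (Katsura.closure_toLimit_eq_top hBfin hA hAB hin) ?_
  rintro _ ⟨α, rfl⟩
  obtain ⟨z, hz, hΨz⟩ := hΨ α
  obtain rfl : z = Katsura.diagCycle hS α := Subtype.ext (DFunLike.coe_injective hz)
  exact (Ψ.symm_apply_eq.2 hΨz.symm).trans (Φ.symm_apply_eq.2 (hΦ α).symm).symm

theorem mainTheorem3 {V : Type*} [Countable V] (A B : Matrix V V ℤ)
    (hA : ∀ i j, 0 ≤ A i j)
    (hAfin : Katsura.RowFinite A) (hBfin : Katsura.RowFinite B)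
    (hArow : ∀ i, ∃ j, A i j ≠ 0) (hBrow : ∀ i, ∃ j, B i j ≠ 0)
    (hAB : ∀ i j, A i j = 0 → B i j = 0)
    (hpf : Katsura.PseudoFree A B)
    (hsrc : Finite V ∨ ∀ j, ∃ i, A i j ≠ 0) :
    ∃! Φ : (Katsura.kerGroupoid A B).H₁ ≃+ Katsura.IndLimit B hBfin,
      ∀ α : Katsura.FinPath A, ∃ z : (Katsura.kerGroupoid A B).cycles₁,
        ⇑(z : C_c({g : Katsura.Arrow A B // Katsura.Arrow.ρ g = 0}, ℤ)) =
          Set.indicator (Katsura.diagSet A B α 1) 1 ∧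
        Φ ((Katsura.kerGroupoid A B).homologyClass z) =
          Katsura.toLimit B hBfin α.length (Finsupp.single α.tgt 1) :=
  mainTheorem3_general A B hA hAfin hBfin hArow hAB hpf hsrc
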